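/- Let $A=(A_{ij})_{i,j=0}^{\ell}$ be an indecomposable generalised Cartan matrix of affine type, and let $a_i$, $\check a_i$ be the relatively prime positive integers with $\sum_j A_{ij}a_j=0$ and $\sum_i \check a_i A_{ij}=0$. Assume $a_0=\check a_0=1$ (this covers every untwisted affine Cartan matrix, with its affine node numbered $0$), and put $h^\vee=\sum_i\check a_i$. Let $\mathfrak h$ be the Cartan subalgebra of $\mathfrak g(A)$, with basis $\check\alpha_0,\dots,\check\alpha_\ell,\mathsf d$, where $\langle\alpha_j,\check\alpha_i\rangle=A_{ij}$ and $\langle\alpha_i,\mathsf d\rangle=\delta_{i,0}$. Let ${}^L\mathfrak g=\mathfrak g({}^tA)$ be the affine Kac–Moody algebra over $\mathbb C$ defined by the Chevalley–Serre relations, with Cartan subalgebra ${}^L\mathfrak h=\mathfrak h^*$, simple coroots $\alpha_i$, simple roots $\check\alpha_i$, Chevalley generators $\check e_i,\check f_i$, derived subalgebra ${}^L\mathfrak g'$, and principal gradation ${}^L\mathfrak g=\bigoplus_n{}^L\mathfrak g_n$ (${}^L\mathfrak g_n$ is the sum of the root spaces of height $n$); write ${}^L\mathfrak g'_n={}^L\mathfrak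 g_n\cap{}^L\mathfrak g'$. Let $(\cdot|\cdot)$ be the invariant symmetric bilinear form on ${}^L\mathfrak g$ extending the one transported to ${}^L\mathfrak h$ from the form on $\mathfrak h$ with $(\check\alpha_i|x)=a_i\check a_i^{-1}\langle\alpha_i,x\rangle$ and $(\mathsf d|\mathsf d)=0$. Let $\rho\in{}^L\mathfrak h$ be the element with $\langle\rho,\check\alpha_i\rangle=1$ for all $i$ and $(\rho|\rho)=0$, and put $\delta=\sum_i a_i\alpha_i$, $p_{-1}=\sum_i\check f_i$, $p_1=\sum_i a_i\check e_i$. For $n\ge1$ let $\mathfrak a_n=\{x\in{}^L\mathfrak g'_n : [p_{-1},x]\in\mathbb C\delta\}$; in particular $\mathfrak a_1=\mathbb Cp_1$. Let $\mathcal M$ be the field of meromorphic functions on $\mathbb P^1$ (in a fixed coordinate $z$), and let $\varphi\in\mathcal M$. Extend $(\cdot|\cdot)$ to ${}^L\mathfrak g\otimes\mathcal M$ by $\mathcal M$-bilinearity. Let $\mathrm{op}^\varphi$ be the space of connections $$\nabla=d+p_{-1}\,dz-\tfrac{\varphi}{h^\vee}\rho\,dz+\sum_{n\ge0}u_n\,dz,\qquad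 u_n\in{}^L\mathfrak g'_n\otimes\mathcal M,$$ where the sum over $n$ is formal. The exponentials $g=\exp(m)$ of formal sums $m=\sum_{n>0}m_n$, $m_n\in{}^L\mathfrak g_n\otimes\mathcal M$, act on $\mathrm{op}^\varphi$ by gauge transformations: $d+b\,dz\mapsto d+gbg^{-1}dz-(dg)g^{-1}$, with $gbg^{-1}=\sum_{k\ge0}\frac1{k!}\mathrm{ad}_m^k b$ and $(dg)g^{-1}=\sum_{k\ge1}\frac1{k!}\mathrm{ad}_m^{k-1}dm$. An oper $[\nabla]$ is a class in the quotient $\mathrm{Op}^\varphi$ of $\mathrm{op}^\varphi$ by these transformations. A representative is in quasi-canonical form if it is $d+\big(p_{-1}-\frac{\varphi}{h^\vee}\rho+\sum_{n\ge1}v^{(n)}\big)dz$ with $v^{(n)}\in\mathfrak a_n\otimes\mathcal M$ for all $n\geq 1$. Its coefficient of $p_1$ is the function $v_1\in\mathcal M$ with $v^{(1)}=v_1p_1$. **Proposition.** Let $[\nabla]\in\mathrm{Op}^\varphi$, and let $\nabla=d+p_{-1}dz-\frac{\varphi}{h^\vee}\rho\,dz+\sum_{n\ge0}u_n\,dz$,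 with $u_n\in{}^L\mathfrak g'_n\otimes\mathcal M$, be any representative of $[\nabla]$. In any quasi-canonical form of $[\nabla]$ the coefficient of $p_1$ is $$v_1=\frac1{h^\vee}\Big(\tfrac12(u_0|u_0)+(\rho|u_0')-\frac{\varphi}{h^\vee}(\rho|u_0)+(p_{-1}|u_1)\Big),$$ where $u_0'=\partial_zu_0$. -/

import Mathlib

open scoped TensorProduct

/-! ### Meromorphic functions on the Riemann sphere

The field of meromorphic functions on the Riemann sphere, with a fixed coordinate `z`, is the field
`RatFunc ℂ` of rational functions in `z`. -/

/-- The derivative `d/dz` of a rational function, by the quotient rule. -/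
noncomputable def ratDerivFun (f : RatFunc ℂ) : RatFunc ℂ :=
  algebraMap (Polynomial ℂ) (RatFunc ℂ)
      (Polynomial.derivative f.num * f.denom - f.num * Polynomial.derivative f.denom) /
    algebraMap (Polynomial ℂ) (RatFunc ℂ) f.denom ^ 2

/-- The quotient rule holds for every fraction representing a rational function. -/
theorem ratDerivFun_div (p q : Polynomial ℂ) (hq : q ≠ 0) :
    ratDerivFun (algebraMap (Polynomial ℂ) (RatFunc ℂ) p /
        algebraMap (Polynomial ℂ) (RatFunc ℂ) q) =
      algebraMap (Polynomial ℂ) (RatFunc ℂ)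
        (Polynomial.derivative p * q - p * Polynomial.derivative q) /
      algebraMap (Polynomial ℂ) (RatFunc ℂ) q ^ 2 := by
  obtain ⟨f, hf⟩ : ∃ f : RatFunc ℂ, f = algebraMap (Polynomial ℂ) (RatFunc ℂ) p /
    algebraMap (Polynomial ℂ) (RatFunc ℂ) q := ⟨_, rfl⟩
  rw [← hf, ratDerivFun]
  have hc : f.num * q = p * f.denom := (RatFunc.num_mul_eq_mul_denom_iff hq).2 hf
  have hd' : algebraMap (Polynomial ℂ) (RatFunc ℂ) f.denom ≠ 0 :=
    RatFunc.algebraMap_ne_zero f.denom_ne_zero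
  have hq' : algebraMap (Polynomial ℂ) (RatFunc ℂ) q ≠ 0 := RatFunc.algebraMap_ne_zero hq
  generalize f.num = n at *
  generalize f.denom = d at *
  have hc' : Polynomial.derivative n * q + n * Polynomial.derivative q =
      Polynomial.derivative p * d + p * Polynomial.derivative d := by
    rw [← Polynomial.derivative_mul, ← Polynomial.derivative_mul, hc]
  have key : (Polynomial.derivative n * d - n * Polynomial.derivative d) * q ^ 2 =
      (Polynomial.derivative p * q - p * Polynomial.derivative q) * d ^ 2 := by
    linear_combination (q * d) * hc' -
      (q * Polynomial.derivative d + d * Polynomial.derivative q) * hc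
  rw [div_eq_div_iff (pow_ne_zero 2 hd') (pow_ne_zero 2 hq'), ← map_pow, ← map_pow,
    ← map_mul, ← map_mul, key]

/-- The derivation `d/dz` of the field of rational functions. -/
noncomputable def ratDeriv : Derivation ℂ (RatFunc ℂ) (RatFunc ℂ) :=
  Derivation.mk'
    { toFun := ratDerivFun
      map_add' := by
        intro f g
        have hf : algebraMap (Polynomial ℂ) (RatFunc ℂ) f.denom ≠ 0 :=
          RatFunc.algebraMap_ne_zero f.denom_ne_zero
        have hg : algebraMap (Polynomial ℂ) (RatFunc ℂ) g.denom ≠ 0 :=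
          RatFunc.algebraMap_ne_zero g.denom_ne_zero
        have h : f + g = algebraMap (Polynomial ℂ) (RatFunc ℂ)
            (f.num * g.denom + f.denom * g.num) /
            algebraMap (Polynomial ℂ) (RatFunc ℂ) (f.denom * g.denom) := by
          conv_lhs => rw [← RatFunc.num_div_denom f, ← RatFunc.num_div_denom g]
          rw [div_add_div _ _ hf hg]
          simp only [map_add, map_mul]
        rw [h, ratDerivFun_div _ _ (mul_ne_zero f.denom_ne_zero g.denom_ne_zero), ratDerivFun,
          ratDerivFun, div_add_div _ _ (pow_ne_zero 2 hf) (pow_ne_zero 2 hg)]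
        simp only [Polynomial.derivative_mul, map_mul, map_sub, map_add]
        rw [← mul_pow]
        congr 1
        ring
      map_smul' := by
        intro c f
        have h : c • f = algebraMap (Polynomial ℂ) (RatFunc ℂ) (c • f.num) /
            algebraMap (Polynomial ℂ) (RatFunc ℂ) f.denom := by
          conv_lhs => rw [← RatFunc.num_div_denom f]
          rw [RatFunc.div_smul]
        rw [h, ratDerivFun_div _ _ f.denom_ne_zero, ratDerivFun, RingHom.id_apply, ← map_pow,
          ← RatFunc.div_smul]
        congr 2
        rw [Polynomial.derivative_smul, smul_mul_assoc, smul_mul_assoc, smul_sub] }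
    (by
      intro f g
      have hf : algebraMap (Polynomial ℂ) (RatFunc ℂ) f.denom ≠ 0 :=
        RatFunc.algebraMap_ne_zero f.denom_ne_zero
      have hg : algebraMap (Polynomial ℂ) (RatFunc ℂ) g.denom ≠ 0 :=
        RatFunc.algebraMap_ne_zero g.denom_ne_zero
      have h : f * g = algebraMap (Polynomial ℂ) (RatFunc ℂ) (f.num * g.num) /
          algebraMap (Polynomial ℂ) (RatFunc ℂ) (f.denom * g.denom) := by
        conv_lhs => rw [← RatFunc.num_div_denom f, ← RatFunc.num_div_denom g]
        rw [div_mul_div_comm, map_mul, map_mul]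
      change ratDerivFun (f * g) = f * ratDerivFun g + g * ratDerivFun f
      rw [h, ratDerivFun_div _ _ (mul_ne_zero f.denom_ne_zero g.denom_ne_zero)]
      conv_rhs =>
        enter [1, 1]
        rw [← RatFunc.num_div_denom f]
      conv_rhs =>
        enter [2, 1]
        rw [← RatFunc.num_div_denom g]
      rw [ratDerivFun, ratDerivFun]
      simp only [Polynomial.derivative_mul, map_mul, map_sub, map_add]
      field_simp
      ring)

/-! ### Affine Cartan data -/

/-- An indecomposable generalised Cartan matrix `A` of affine type, rows and columns indexed by
`0, …, ℓ`, with the positive relatively prime integers `a i` and `aCheck i` such that `A a = 0` and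
`Aᵀ aCheck = 0`, normalised so that `a 0 = 1` and `aCheck 0 = 1`. Every untwisted affine Cartan
matrix, with its affine node numbered `0`, is of this kind. -/
structure AffineCartanDatum (ℓ : ℕ) where
  A : Matrix (Fin (ℓ + 1)) (Fin (ℓ + 1)) ℤ
  diag : ∀ i, A i i = 2
  offDiag : ∀ i j, i ≠ j → A i j ≤ 0
  zero_symm : ∀ i j, A i j = 0 → A j i = 0
  indecomposable : ∀ s : Set (Fin (ℓ + 1)), s.Nonempty → sᶜ.Nonempty →
    ∃ i ∈ s, ∃ j ∈ sᶜ, A i j ≠ 0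
  a : Fin (ℓ + 1) → ℕ
  a_pos : ∀ i, 0 < a i
  a_zero : a 0 = 1
  a_null : ∀ i, ∑ j, A i j * (a j : ℤ) = 0
  aCheck : Fin (ℓ + 1) → ℕ
  aCheck_pos : ∀ i, 0 < aCheck i
  aCheck_zero : aCheck 0 = 1
  aCheck_null : ∀ j, ∑ i, A i j * (aCheck i : ℤ) = 0

/-- The Cartan subalgebra `𝔥` of `𝔤(A)`: the pair `(x, t)` is `∑ x i α̌_i + t d`, where `d` is the
derivation element with `⟨α_i, d⟩ = δ_{i,0}`. -/
abbrev CartanH (ℓ : ℕ) : Type := (Fin (ℓ + 1) → ℂ) × ℂ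

/-- The dual `𝔥* = ᴸ𝔥`, the Cartan subalgebra of `ᴸ𝔤`: the pair `(y, s)` is `∑ y i α_i + s Λ₀`,
where `Λ₀` is the fundamental weight with `⟨Λ₀, α̌_i⟩ = δ_{i,0}` and `⟨Λ₀, d⟩ = 0`. -/
abbrev CartanLH (ℓ : ℕ) : Type := (Fin (ℓ + 1) → ℂ) × ℂ

/-- Generators of `ᴸ𝔤`: the Cartan subalgebra `ᴸ𝔥` and the Chevalley generators. -/
inductive LGen (ℓ : ℕ) : Type
  | h (x : CartanLH ℓ) : LGen ℓ
  | e (i : Fin (ℓ + 1)) : LGen ℓ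
  | f (i : Fin (ℓ + 1)) : LGen ℓ

namespace AffineCartanDatum

variable {ℓ : ℕ} (C : AffineCartanDatum ℓ)

/-- The simple coroot `α̌_i ∈ 𝔥`. -/
def coroot (i : Fin (ℓ + 1)) : CartanH ℓ := (Pi.single i 1, 0)

/-- The derivation element `d ∈ 𝔥`. -/
def derivElt : CartanH ℓ := (0, 1)

/-- The simple root `α_i ∈ 𝔥*`. -/
def root (i : Fin (ℓ + 1)) : CartanLH ℓ := (Pi.single i 1, 0)

/-- The canonical pairing `⟨·,·⟩` of `𝔥* = ᴸ𝔥` with `𝔥`; in particular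
`⟨α_j, α̌_i⟩ = A i j`. -/
noncomputable def pair (y : CartanLH ℓ) (x : CartanH ℓ) : ℂ :=
  ∑ i, ∑ j, x.1 i * (C.A i j : ℂ) * y.1 j + y.1 0 * x.2 + y.2 * x.1 0

/-- The dual Coxeter number `h^∨ = ∑ ǎ_i` of `𝔤`. -/
def hDual : ℕ := ∑ i, C.aCheck i

/-- The central element `k = ∑ ǎ_i α̌_i` of `𝔤`. -/
noncomputable def kElt : CartanH ℓ := ∑ i, (C.aCheck i : ℂ) • coroot i

/-- The element `δ = ∑ a_i α_i` of `ᴸ𝔥`. -/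
noncomputable def delta : CartanLH ℓ := ∑ i, (C.a i : ℂ) • root i

/-- The bilinear form on `𝔥` with `(α̌_i | x) = a_i ǎ_i⁻¹ ⟨α_i, x⟩` and `(d | d) = 0`. -/
noncomputable def formH (x x' : CartanH ℓ) : ℂ :=
  ∑ i, x.1 i * ((C.a i : ℂ) / (C.aCheck i : ℂ) * C.pair (root i) x') +
    x.2 * ∑ i, x'.1 i * ((C.a i : ℂ) / (C.aCheck i : ℂ) * C.pair (root i) derivElt)

/-- The inverse of the isomorphism `ν : 𝔥 → ᴸ𝔥`, `x ↦ (x | ·)`, which sends `α̌_i` to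
`a_i ǎ_i⁻¹ α_i` and `d` to `Λ₀`. -/
noncomputable def nuInv (y : CartanLH ℓ) : CartanH ℓ :=
  (fun i => (C.aCheck i : ℂ) / (C.a i : ℂ) * y.1 i, y.2)

/-- `nuInv y` is the element of `𝔥` that represents `y ∈ 𝔥*` through the bilinear form on `𝔥`. -/
theorem formH_nuInv (y : CartanLH ℓ) (x : CartanH ℓ) : C.formH (C.nuInv y) x = C.pair y x := by
  have hA : ∀ i, (C.a i : ℂ) ≠ 0 := fun i => Nat.cast_ne_zero.2 (C.a_pos i).ne'
  have hB : ∀ i, (C.aCheck i : ℂ) ≠ 0 := fun i => Nat.cast_ne_zero.2 (C.aCheck_pos i).ne'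
  have h1 : ∀ i, C.pair (root i) x = ∑ k, x.1 k * (C.A k i : ℂ) + (if i = 0 then x.2 else 0) := by
    intro i
    simp [pair, root, Pi.single_apply, eq_comm]
  have h2 : ∀ i : Fin (ℓ + 1), C.pair (root i) derivElt = if i = 0 then 1 else 0 := by
    intro i
    simp [pair, root, derivElt, Pi.single_apply, eq_comm]
  have h3 : ∀ i, (C.nuInv y).1 i * ((C.a i : ℂ) / (C.aCheck i : ℂ) * C.pair (root i) x) =
      y.1 i * C.pair (root i) x := by
    intro i
    have := hA i
    have := hB i
    simp only [nuInv]
    field_simp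
  have h4 : C.pair y x = ∑ i, y.1 i * ∑ k, x.1 k * (C.A k i : ℂ) + y.1 0 * x.2 + y.2 * x.1 0 := by
    rw [pair, Finset.sum_comm]
    congr 2
    refine Finset.sum_congr rfl fun i _ => ?_
    rw [Finset.mul_sum]
    exact Finset.sum_congr rfl fun j _ => by ring
  rw [formH, Finset.sum_congr rfl fun i _ => h3 i, h4]
  simp only [h1, h2, nuInv]
  simp [C.a_zero, C.aCheck_zero, mul_add, Finset.sum_add_distrib]

/-- The bilinear form on `ᴸ𝔥` transported from `𝔥` along `ν`. -/
noncomputable def formLH (y y' : CartanLH ℓ) : ℂ := C.formH (C.nuInv y) (C.nuInv y')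

/-- The defining properties of `ρ ∈ ᴸ𝔥`: `⟨ρ, α̌_i⟩ = 1` for all `i`, and `(ρ | ρ) = 0`. There is
exactly one such element. -/
def IsRho (r : CartanLH ℓ) : Prop := (∀ i, C.pair r (coroot i) = 1) ∧ C.formLH r r = 0

/-- The element `ρ ∈ ᴸ𝔥`. -/
noncomputable def rho : CartanLH ℓ := Classical.epsilon C.IsRho

/-! ### The affine Kac-Moody algebra `ᴸ𝔤 = 𝔤(ᵗA)` -/

/-- The free generator attached to `x ∈ ᴸ𝔥`. -/
noncomputable def freeH (x : CartanLH ℓ) : FreeLieAlgebra ℂ (LGen ℓ) := FreeLieAlgebra.of ℂ (LGen.h x)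

/-- The free generator attached to `ě_i`. -/
noncomputable def freeE (i : Fin (ℓ + 1)) : FreeLieAlgebra ℂ (LGen ℓ) := FreeLieAlgebra.of ℂ (LGen.e i)

/-- The free generator attached to `f̌_i`. -/
noncomputable def freeF (i : Fin (ℓ + 1)) : FreeLieAlgebra ℂ (LGen ℓ) := FreeLieAlgebra.of ℂ (LGen.f i)

/-- The relators of `ᴸ𝔤`: linearity of `ᴸ𝔥`, the Chevalley relations and the Serre relations. The
Cartan matrix of `ᴸ𝔤` is the transpose of `A`. -/
inductive IsRelator : FreeLieAlgebra ℂ (LGen ℓ) → Prop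
  | h_add (x y : CartanLH ℓ) : IsRelator (freeH (x + y) - (freeH x + freeH y))
  | h_smul (c : ℂ) (x : CartanLH ℓ) : IsRelator (freeH (c • x) - c • freeH x)
  | h_h (x y : CartanLH ℓ) : IsRelator ⁅freeH x, freeH y⁆
  | h_e (x : CartanLH ℓ) (i : Fin (ℓ + 1)) :
      IsRelator (⁅freeH x, freeE i⁆ - C.pair x (coroot i) • freeE i)
  | h_f (x : CartanLH ℓ) (i : Fin (ℓ + 1)) :
      IsRelator (⁅freeH x, freeF i⁆ + C.pair x (coroot i) • freeF i)
  | e_f_same (i : Fin (ℓ + 1)) : IsRelator (⁅freeE i, freeF i⁆ - freeH (root i))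
  | e_f_ne (i j : Fin (ℓ + 1)) (hij : i ≠ j) : IsRelator ⁅freeE i, freeF j⁆
  | serre_e (i j : Fin (ℓ + 1)) (hij : i ≠ j) :
      IsRelator (((LieAlgebra.ad ℂ (FreeLieAlgebra ℂ (LGen ℓ)) (freeE i)) ^ (1 - C.A j i).toNat)
        (freeE j))
  | serre_f (i j : Fin (ℓ + 1)) (hij : i ≠ j) :
      IsRelator (((LieAlgebra.ad ℂ (FreeLieAlgebra ℂ (LGen ℓ)) (freeF i)) ^ (1 - C.A j i).toNat)
        (freeF j))

/-- The ideal generated by the relators. -/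
noncomputable def relIdeal : LieIdeal ℂ (FreeLieAlgebra ℂ (LGen ℓ)) :=
  LieSubmodule.lieSpan ℂ (FreeLieAlgebra ℂ (LGen ℓ)) {x | C.IsRelator x}

/-- The affine Kac-Moody algebra `ᴸ𝔤` over `ℂ`, by generators and relations. -/
def LG : Type := FreeLieAlgebra ℂ (LGen ℓ) ⧸ C.relIdeal

noncomputable instance : LieRing C.LG :=
  inferInstanceAs (LieRing (FreeLieAlgebra ℂ (LGen ℓ) ⧸ C.relIdeal))

noncomputable instance : LieAlgebra ℂ C.LG :=
  inferInstanceAs (LieAlgebra ℂ (FreeLieAlgebra ℂ (LGen ℓ) ⧸ C.relIdeal))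

/-- The quotient map from the free Lie algebra. -/
noncomputable def toLG : FreeLieAlgebra ℂ (LGen ℓ) →ₗ⁅ℂ⁆ C.LG :=
  { (LieSubmodule.Quotient.mk' C.relIdeal : FreeLieAlgebra ℂ (LGen ℓ) →ₗ[ℂ]
      FreeLieAlgebra ℂ (LGen ℓ) ⧸ C.relIdeal) with
    map_lie' := fun {x y} => LieSubmodule.Quotient.mk_bracket C.relIdeal x y }

/-- Relators vanish in `ᴸ𝔤`. -/
theorem toLG_eq_zero {x : FreeLieAlgebra ℂ (LGen ℓ)} (hx : C.IsRelator x) : C.toLG x = 0 :=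
  (LieSubmodule.Quotient.mk_eq_zero' (N := C.relIdeal)).2 (LieSubmodule.subset_lieSpan hx)

/-- The canonical map `ᴸ𝔥 → ᴸ𝔤`. -/
noncomputable def hEmb : CartanLH ℓ →ₗ[ℂ] C.LG where
  toFun x := C.toLG (freeH x)
  map_add' x y := by
    have h := C.toLG_eq_zero (IsRelator.h_add x y)
    rwa [map_sub, map_add, sub_eq_zero] at h
  map_smul' c x := by
    have h := C.toLG_eq_zero (IsRelator.h_smul c x)
    rwa [map_sub, map_smul, sub_eq_zero] at h

/-- The Chevalley generator `ě_i`. -/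
noncomputable def chevE (i : Fin (ℓ + 1)) : C.LG := C.toLG (freeE i)

/-- The Chevalley generator `f̌_i`. -/
noncomputable def chevF (i : Fin (ℓ + 1)) : C.LG := C.toLG (freeF i)

/-- The cyclic element `p_{-1} = ∑ f̌_i`. -/
noncomputable def pMinusOne : C.LG := ∑ i, C.chevF i

/-- The element `p_1 = ∑ a_i ě_i`. -/
noncomputable def pOne : C.LG := ∑ i, (C.a i : ℂ) • C.chevE i

/-- An invariant symmetric bilinear form on `ᴸ𝔤` extending the one on `ᴸ𝔥`. There is exactly one
such form. -/
def IsInvariantForm (B : LinearMap.BilinForm ℂ C.LG) : Prop :=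
  (∀ x y, B x y = B y x) ∧ (∀ x y z, B ⁅x, y⁆ z = B x ⁅y, z⁆) ∧
    ∀ y y' : CartanLH ℓ, B (C.hEmb y) (C.hEmb y') = C.formLH y y'

/-- The invariant symmetric bilinear form `(· | ·)` on `ᴸ𝔤`. -/
noncomputable def form : LinearMap.BilinForm ℂ C.LG := Classical.epsilon C.IsInvariantForm

/-! ### Principal gradation and principal subalgebra -/

/-- The root space of `∑ r i α̌_i` in `ᴸ𝔤`. -/
noncomputable def rootSpace (r : Fin (ℓ + 1) → ℤ) : Submodule ℂ C.LG :=
  ⨅ y : CartanLH ℓ, LinearMap.ker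
    (LieAlgebra.ad ℂ C.LG (C.hEmb y) - C.pair y (∑ i, (r i : ℂ) • coroot i) • LinearMap.id)

/-- The subspace `ᴸ𝔤_n` of degree `n` in the principal gradation: the sum of the root spaces of
height `n`. -/
noncomputable def grade (n : ℤ) : Submodule ℂ C.LG :=
  ⨆ r : {r : Fin (ℓ + 1) → ℤ // ∑ i, r i = n}, C.rootSpace r.1

/-- The derived subalgebra `ᴸ𝔤' = [ᴸ𝔤, ᴸ𝔤]`. -/
noncomputable def derivedLG : Submodule ℂ C.LG :=
  (LieAlgebra.derivedSeries ℂ C.LG 1).toSubmodule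

/-- The subspace `ᴸ𝔤'_n` of degree `n` of the derived subalgebra. -/
noncomputable def derivedGrade (n : ℤ) : Submodule ℂ C.LG := C.grade n ⊓ C.derivedLG

/-- The subspace `𝔞_n` of the principal subalgebra, for `n ≠ 0`: the elements of `ᴸ𝔤'_n` whose
class in `ᴸ𝔤' / ℂδ` commutes with the class of `p_{-1}`. -/
noncomputable def principalGrade (n : ℤ) : Submodule ℂ C.LG :=
  C.derivedGrade n ⊓ (Submodule.span ℂ {C.hEmb C.delta}).comap
    (LieAlgebra.ad ℂ C.LG C.pMinusOne)

/-! ### Opers -/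

/-- The Lie algebra `ᴸ𝔤(ℳ) = ℳ ⊗ ᴸ𝔤` of `ᴸ𝔤`-valued meromorphic functions on the sphere. -/
abbrev LGM : Type := RatFunc ℂ ⊗[ℂ] C.LG

/-- The derivative of a `ᴸ𝔤`-valued meromorphic function with respect to `z`. -/
noncomputable def derivLGM : C.LGM →ₗ[ℂ] C.LGM :=
  LinearMap.rTensor C.LG (ratDeriv : RatFunc ℂ →ₗ[ℂ] RatFunc ℂ)

/-- The bilinear form on `ᴸ𝔤(ℳ)` with values in `ℳ`. -/
noncomputable def formM : LinearMap.BilinForm (RatFunc ℂ) C.LGM :=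
  LinearMap.BilinForm.baseChange (RatFunc ℂ) C.form

/-- The function `f x`, for `f` a meromorphic function and `x ∈ ᴸ𝔤`. -/
noncomputable def smulConst (f : RatFunc ℂ) (x : C.LG) : C.LGM := f ⊗ₜ[ℂ] x

/-- The constant function with value `x ∈ ᴸ𝔤`. -/
noncomputable def const (x : C.LG) : C.LGM := C.smulConst 1 x

/-- The family of homogeneous components whose only component is `x`, in degree `0`. -/
noncomputable def inDegreeZero (x : C.LGM) : ℕ → C.LGM := fun n => if n = 0 then x else 0

/-- An element `∑_{n > 0} m n` of the completion `ᴸ𝔫̂₊(ℳ)`, given by its homogeneous components;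
`m n` has degree `n`. -/
def IsNPlus (m : ℕ → C.LGM) : Prop :=
  m 0 = 0 ∧ ∀ n : ℕ, m n ∈ (C.grade (n : ℤ)).baseChange (RatFunc ℂ)

/-- An element `∑_{n ≥ 0} b n` of the completion `ᴸ𝔟̂₊(ℳ)`, given by its homogeneous components. -/
def IsBPlus (b : ℕ → C.LGM) : Prop :=
  ∀ n : ℕ, b n ∈ (C.grade (n : ℤ)).baseChange (RatFunc ℂ)

/-- An element `∑_{n ≥ 0} b n` of the completion `ᴸ𝔟̂'₊(ℳ)`, where `ᴸ𝔟'₊ = ᴸ𝔟₊ ∩ ᴸ𝔤'`. -/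
def IsDerivedBPlus (b : ℕ → C.LGM) : Prop :=
  ∀ n : ℕ, b n ∈ (C.derivedGrade (n : ℤ)).baseChange (RatFunc ℂ)

/-- The connection `d + p_{-1} dz + b dz`, an element of `op(ℙ¹)`. -/
structure Conn where
  b : ℕ → C.LGM
  mem : C.IsBPlus b

/-- The operator `ad_m` on families of homogeneous components: `m r` has degree `r`, and `x j` has
degree `j + c` for a constant `c`. -/
noncomputable def adFam (m x : ℕ → C.LGM) : ℕ → C.LGM :=
  fun j => ∑ p ∈ Finset.HasAntidiagonal.antidiagonal j, ⁅m p.1, x p.2⁆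

/-- The family of components, of degrees `-1, 0, 1, …`, of `p_{-1} + b`. -/
noncomputable def withCyclic (b : ℕ → C.LGM) : ℕ → C.LGM
  | 0 => C.const C.pMinusOne
  | n + 1 => b n

/-- `g x g⁻¹ = ∑_{k ≥ 0} (1/k!) ad_m^k x` for `g = exp m`, by components. As `ad_m` raises degrees,
only the terms `k ≤ j` contribute to the `j`-th component. -/
noncomputable def AdExp (m x : ℕ → C.LGM) : ℕ → C.LGM :=
  fun j => ∑ k ∈ Finset.range (j + 1), ((k.factorial : ℂ)⁻¹) • (C.adFam m)^[k] x j

/-- `∂_z g g⁻¹ = ∑_{k ≥ 1} (1/k!) ad_m^{k-1} ∂_z m` for `g = exp m`, by components. Only the terms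
`k ≤ n` contribute in degree `n`. -/
noncomputable def logDerivExp (m : ℕ → C.LGM) : ℕ → C.LGM :=
  fun n => ∑ k ∈ Finset.Icc 1 n,
    ((k.factorial : ℂ)⁻¹) • (C.adFam m)^[k - 1] (fun r => C.derivLGM (m r)) n

/-- The components of `b'` in the gauge transform
`d + p_{-1} dz + b' dz = d + g (p_{-1} + b) g⁻¹ dz - (dg) g⁻¹`, for `g = exp m`. -/
noncomputable def gaugeTransform (m b : ℕ → C.LGM) : ℕ → C.LGM :=
  fun n => C.AdExp m (C.withCyclic b) (n + 1) - C.logDerivExp m n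

/-- A derivation element `Λ` of `ᴸ𝔥` is normalised when `⟨Λ, k⟩ = 1`. -/
def IsNormalised (y : CartanLH ℓ) : Prop := C.pair y C.kElt = 1

/-- Membership in `op(ℙ¹)^φ`: the connection is `d + p_{-1} dz - Λ φ dz + b' dz` with `Λ` a
normalised derivation element and `b' ∈ ᴸ𝔟̂'₊(ℳ)`. -/
def IsTwisted (φ : RatFunc ℂ) (D : C.Conn) : Prop :=
  ∃ y : CartanLH ℓ, C.IsNormalised y ∧ ∃ b' : ℕ → C.LGM, C.IsDerivedBPlus b' ∧
    D.b = b' - C.inDegreeZero (C.smulConst φ (C.hEmb y))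

/-- The space `op(ℙ¹)^φ`. -/
abbrev TwistedConn (φ : RatFunc ℂ) : Type := {D : C.Conn // C.IsTwisted φ D}

/-- The connection `D'` is the gauge transform of `D` by some `exp m` in the group `ᴸN̂₊(ℳ)`, every
element of which is such an exponential. -/
def GaugeRel (φ : RatFunc ℂ) (D D' : C.TwistedConn φ) : Prop :=
  ∃ m : ℕ → C.LGM, C.IsNPlus m ∧ D'.1.b = C.gaugeTransform m D.1.b

/-- The space `Op(ℙ¹)^φ` of `ᴸ𝔤`-opers: the quotient of `op(ℙ¹)^φ` by gauge transformations. -/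
def Oper (φ : RatFunc ℂ) : Type := Quot (C.GaugeRel φ)

/-- The class `[∇]` of a connection. -/
def operClass (φ : RatFunc ℂ) (D : C.TwistedConn φ) : C.Oper φ := Quot.mk _ D

/-- Quasi-canonical form: the connection is `d + p_{-1} dz - (φ / h^∨) ρ dz + a dz` with
`a = ∑_{n ≥ 1} a_n` and `a_n ∈ 𝔞_n(ℳ)`. -/
def IsQuasiCanonical (φ : RatFunc ℂ) (D : C.Conn) : Prop :=
  D.b 0 = -C.smulConst (φ / (C.hDual : RatFunc ℂ)) (C.hEmb C.rho) ∧
    ∀ n : ℕ, 1 ≤ n → D.b n ∈ (C.principalGrade (n : ℤ)).baseChange (RatFunc ℂ)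

end AffineCartanDatum

/-! ### Affine Cartan matrices -/

namespace AffineCartanDatum

variable {ℓ : ℕ} (C : AffineCartanDatum ℓ)

/-! The function F(b) = ½(b₀|b₀) + (ρ|b₀′) + (p₋₁|b₁) of a connection d + p₋₁dz + b dz
(`operFunction`) is gauge invariant, hence depends only on the oper. Put c = [m₁, p₋₁]. Under
exp(m), b₀ becomes b₀ + c and b₁ gains [m₁, b₀] + [m₂, p₋₁] + ½[m₁, c] − m₁′. By invariance of the
form, the change of ½(b₀|b₀) cancels against (p₋₁|[m₁, b₀] + ½[m₁, c]), the m₂ term pairs to zero,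
and (ρ|c′) = ([ρ, m₁′]|p₋₁) = (m₁′|p₋₁) cancels the contribution of −m₁′
(`operFunction_gaugeTransform`). In quasi-canonical form b₀ is a multiple of the isotropic vector ρ
and b₁ = v₁p₁, so F = v₁(p₋₁|p₁) = h^∨v₁. Evaluating F on another representative gives the formula.

Most of the work is the foundation. Both ρ and the form are chosen by `Classical.epsilon`, so
nothing is known of them until existence is proved. The null vectors a, ǎ force A to be
symmetrisable (`symmetrized`), and then the kernel of A is a line (`kernel_complex`); this yields ρ
and 𝔞₁ ⊆ ℂp₁.

The form is first built on the algebra without Serre relations. In degree n ≠ 0 invariance forces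
n(x|y) = (ρ|[x, y]), which is taken as the definition; it needs a projection to the Cartan
subalgebra, read off from Verma modules. Invariance is checked on generators and carried to all
degrees by induction (`GradedFormData.cyclicOn`). The Serre elements lie in the radical, so the form
descends to ᴸ𝔤 (`exists_isInvariantForm`). -/

theorem A_mul_A_ge_one {i j : Fin (ℓ + 1)} (h : C.A i j ≠ 0) : 1 ≤ C.A i j * C.A j i := by
  rcases eq_or_ne i j with rfl | hij
  · rw [C.diag]; norm_num
  have h' : C.A j i ≠ 0 := fun h' => h (C.zero_symm _ _ h')
  have h1 := C.offDiag i j hij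
  have h2 := C.offDiag j i hij.symm
  have h1' : C.A i j ≤ -1 := by omega
  have h2' : C.A j i ≤ -1 := by omega
  nlinarith

/-- Along the arrows of a map on a set of vertices without fixed points and 2-cycles, which joins
neighbours in the Dynkin diagram, the entries of a positive null vector are constant. -/
theorem null_eq_of_cycle {V : Type*} [Fintype V] [DecidableEq V] (A : Matrix V V ℤ) (a : V → ℝ)
    (ha : ∀ i, 0 < a i) (hdiag : ∀ i, A i i = 2) (hoff : ∀ i j, i ≠ j → A i j ≤ 0)
    (hprod : ∀ i j, A i j ≠ 0 → 1 ≤ A i j * A j i)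
    (hnull : ∀ i, ∑ j, (A i j : ℝ) * a j = 0) (P : Finset V) (σ : V → V)
    (hσP : ∀ i ∈ P, σ i ∈ P) (hσ1 : ∀ i ∈ P, σ i ≠ i) (hσ2 : ∀ i ∈ P, σ (σ i) ≠ i)
    (hσA : ∀ i ∈ P, A i (σ i) ≠ 0) :
    ∀ i ∈ P, A i (σ i) = -1 ∧ A (σ i) i = -1 ∧ a (σ i) = a i := by
  -- Conjugating A by the diagonal matrix of a makes all row sums zero and preserves the products of
  -- opposite entries.
  set b : V → V → ℝ := fun i j => A i j * a j / a i with hb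
  have hoff' : ∀ i j, i ≠ j → b i j ≤ 0 := fun i j hij =>
    div_nonpos_of_nonpos_of_nonneg (mul_nonpos_of_nonpos_of_nonneg
      (by exact_mod_cast hoff i j hij) (ha j).le) (ha i).le
  have hdiag' : ∀ i, b i i = 2 := fun i => by
    simp only [hb, hdiag]; rw [mul_div_assoc, div_self (ha i).ne']; norm_num
  have hrow : ∀ i, ∑ j, b i j = 0 := fun i => by
    simp only [hb]; rw [← Finset.sum_div, hnull, zero_div]
  have hrowP : ∀ i ∈ P, 0 ≤ ∑ j ∈ P, b i j := fun i hi => by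
    rw [← hrow i, ← Finset.sum_add_sum_compl P]
    have : ∑ j ∈ Pᶜ, b i j ≤ 0 := Finset.sum_nonpos fun j hj => hoff' i j fun h =>
      Finset.mem_compl.1 hj (h ▸ hi)
    linarith
  have hpr : ∀ i ∈ P, 1 ≤ b i (σ i) * b (σ i) i := fun i hi => by
    have h1 : b i (σ i) * b (σ i) i = ((A i (σ i) * A (σ i) i : ℤ) : ℝ) := by
      have := (ha i).ne'
      have := (ha (σ i)).ne'
      simp only [hb]; push_cast; field_simp
    rw [h1]; exact_mod_cast hprod _ _ (hσA i hi)
  -- Arithmetic-geometric mean: two nonpositive numbers with product at least 1 have sum at most −2.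
  have hedge : ∀ i ∈ P, b i (σ i) + b (σ i) i ≤ -2 := fun i hi => by
    have h1 := hoff' _ _ (hσ1 i hi).symm
    have h2 := hoff' _ _ (hσ1 i hi)
    have h3 := hpr i hi
    nlinarith [sq_nonneg (b i (σ i) - b (σ i) i)]
  -- Keep the diagonal and the entries along arrows in both directions, and drop the rest, which are
  -- nonpositive. Without fixed points and 2-cycles no entry is counted twice.
  have hle : ∀ i ∈ P, ∀ j ∈ P, b i j ≤ (if j = σ i then b i (σ i) else 0) +
      (if i = σ j then b (σ j) j else 0) + (if i = j then 2 else 0) := by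
    intro i hi j hj
    by_cases h1 : j = σ i
    · subst h1
      rw [if_pos rfl, if_neg (hσ2 i hi).symm, if_neg (hσ1 i hi).symm]; simp
    by_cases h2 : i = σ j
    · subst h2
      rw [if_neg h1, if_pos rfl, if_neg (hσ1 j hj)]; simp
    by_cases h3 : i = j
    · subst h3
      simp [h1, hdiag']
    · simpa [h1, h2, h3] using hoff' i j h3
  -- Every summand is nonpositive by `hedge`, so a nonnegative total forces equality on each arrow.
  have hsum : (0 : ℝ) ≤ ∑ i ∈ P, (b i (σ i) + b (σ i) i + 2) := by
    calc (0 : ℝ) ≤ ∑ i ∈ P, ∑ j ∈ P, b i j := Finset.sum_nonneg hrowP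
      _ ≤ ∑ i ∈ P, ∑ j ∈ P, ((if j = σ i then b i (σ i) else 0) +
          (if i = σ j then b (σ j) j else 0) + (if i = j then 2 else 0)) :=
        Finset.sum_le_sum fun i hi => Finset.sum_le_sum fun j hj => hle i hi j hj
      _ = ∑ i ∈ P, (b i (σ i) + b (σ i) i + 2) := by
        simp only [Finset.sum_add_distrib]
        congr 1
        · congr 1
          · refine Finset.sum_congr rfl fun i hi => ?_
            rw [Finset.sum_ite_eq', if_pos (hσP i hi)]
          · rw [Finset.sum_comm]
            refine Finset.sum_congr rfl fun i hi => ?_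
            rw [Finset.sum_ite_eq', if_pos (hσP i hi)]
        · refine Finset.sum_congr rfl fun i hi => ?_
          rw [Finset.sum_ite_eq, if_pos hi]
  have heq : ∀ i ∈ P, b i (σ i) + b (σ i) i + 2 = 0 := by
    refine (Finset.sum_eq_zero_iff_of_nonpos fun i hi => ?_).1
      (le_antisymm (Finset.sum_nonpos fun i hi => ?_) hsum) <;> linarith [hedge i hi]
  intro i hi
  have h1 := hpr i hi
  have h2 := heq i hi
  have h3 : b i (σ i) = -1 := by
    nlinarith [sq_nonneg (b i (σ i) - b (σ i) i), sq_nonneg (b i (σ i) + 1)]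
  have h4 : b (σ i) i = -1 := by linarith
  have h5 : A i (σ i) * A (σ i) i = 1 := by
    have h1 : b i (σ i) * b (σ i) i = ((A i (σ i) * A (σ i) i : ℤ) : ℝ) := by
      have := (ha i).ne'
      have := (ha (σ i)).ne'
      simp only [hb]; push_cast; field_simp
    rw [h3, h4] at h1
    have : ((A i (σ i) * A (σ i) i : ℤ) : ℝ) = ((1 : ℤ) : ℝ) := by rw [← h1]; norm_num
    exact_mod_cast this
  have h6 : A i (σ i) = -1 := by
    rcases Int.mul_eq_one_iff_eq_one_or_neg_one.1 h5 with h | h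
    · have := hoff _ _ (hσ1 i hi).symm; omega
    · exact h.1
  have h7 : A (σ i) i = -1 := by rw [h6] at h5; omega
  refine ⟨h6, h7, ?_⟩
  simp only [hb, h6] at h3
  rw [div_eq_iff (ha i).ne'] at h3
  push_cast at h3
  linarith

/-- The matrix `ǎ_i A_ij a_j` is symmetric. -/
theorem symmetrized (i j : Fin (ℓ + 1)) :
    (C.aCheck i : ℤ) * C.A i j * C.a j = C.aCheck j * C.A j i * C.a i := by
  classical
  set M : Fin (ℓ + 1) → Fin (ℓ + 1) → ℤ := fun i j => C.aCheck i * C.A i j * C.a j with hM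
  change M i j = M j i
  have hrow : ∀ i, ∑ j, M i j = 0 := fun i => by
    simp only [hM, mul_assoc, ← Finset.mul_sum, C.a_null, mul_zero]
  have hcol : ∀ j, ∑ i, M i j = 0 := fun j => by
    have : ∀ i, M i j = C.A i j * C.aCheck i * C.a j := fun i => by simp only [hM]; ring
    simp only [this, ← Finset.sum_mul, C.aCheck_null, zero_mul]
  -- A conservation law: the row and column sums at j agree, so an imbalance of one sign at j is
  -- compensated by one of the other sign. Following imbalances never gets stuck.
  have hout : ∀ j, (∃ i, M i j < M j i) → ∃ k, M j k < M k j := by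
    rintro j ⟨i, hi⟩
    by_contra! hcon
    have : ∑ k, M k j < ∑ k, M j k :=
      Finset.sum_lt_sum (fun k _ => hcon k) ⟨i, Finset.mem_univ _, hi⟩
    rw [hrow, hcol] at this
    exact this.false
  have hnone : ∀ i j, ¬ M i j < M j i := by
    intro i₀ j₀ h₀
    set P : Finset (Fin (ℓ + 1)) := Finset.univ.filter fun i => ∃ j, M i j < M j i with hP
    have hmem : ∀ i, i ∈ P ↔ ∃ j, M i j < M j i := fun i => by simp [hP]
    have hex : ∀ i, ∃ j, i ∈ P → M i j < M j i := fun i => by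
      by_cases hi : i ∈ P
      · obtain ⟨j, hj⟩ := (hmem i).1 hi; exact ⟨j, fun _ => hj⟩
      · exact ⟨i, fun h => (hi h).elim⟩
    choose σ hσ using hex
    have hσP : ∀ i ∈ P, σ i ∈ P := fun i hi => (hmem _).2 (hout _ ⟨i, hσ i hi⟩)
    have hσ1 : ∀ i ∈ P, σ i ≠ i := fun i hi h => by
      have := hσ i hi; rw [h] at this; exact this.false
    have hσ2 : ∀ i ∈ P, σ (σ i) ≠ i := fun i hi h => by
      have h1 := hσ i hi
      have h2 := hσ _ (hσP i hi)
      rw [h] at h2; exact lt_asymm h1 h2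
    have hσA : ∀ i ∈ P, C.A i (σ i) ≠ 0 := fun i hi h => by
      have h1 := hσ i hi
      simp only [hM, h, C.zero_symm _ _ h] at h1
      simp at h1
    have hi₀ : i₀ ∈ P := (hmem _).2 ⟨j₀, h₀⟩
    -- Along σ both null vectors are constant and both entries of A are −1, so M is symmetric there,
    -- against the choice of σ.
    have r1 := null_eq_of_cycle C.A (fun i => (C.a i : ℝ)) (fun i => by exact_mod_cast C.a_pos i)
      C.diag C.offDiag (fun _ _ => C.A_mul_A_ge_one) (fun i => by exact_mod_cast C.a_null i) P σ
      hσP hσ1 hσ2 hσA i₀ hi₀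
    have r2 := null_eq_of_cycle C.A.transpose (fun i => (C.aCheck i : ℝ))
      (fun i => by exact_mod_cast C.aCheck_pos i) C.diag (fun i j h => C.offDiag j i h.symm)
      (fun i j h => C.A_mul_A_ge_one h) (fun i => by exact_mod_cast C.aCheck_null i) P σ
      hσP hσ1 hσ2 (fun i hi h => hσA i hi (C.zero_symm _ _ h)) i₀ hi₀
    have h1 : C.a (σ i₀) = C.a i₀ := by exact_mod_cast r1.2.2
    have h2 : C.aCheck (σ i₀) = C.aCheck i₀ := by exact_mod_cast r2.2.2
    have h3 := hσ i₀ hi₀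
    simp only [hM, r1.1, r1.2.1, h1, h2] at h3
    exact h3.false
  exact le_antisymm (not_lt.1 (hnone j i)) (not_lt.1 (hnone i j))

/-- The real kernel of `A` is spanned by the vector `a`. -/
theorem kernel_real (y : Fin (ℓ + 1) → ℝ) (hy : ∀ i, ∑ j, (C.A i j : ℝ) * y j = 0) :
    ∀ i, y i = y 0 * C.a i := by
  have ha : ∀ i, (0 : ℝ) < C.a i := fun i => by exact_mod_cast C.a_pos i
  have hb : ∀ i, (0 : ℝ) < C.aCheck i := fun i => by exact_mod_cast C.aCheck_pos i
  set z : Fin (ℓ + 1) → ℝ := fun i => y i / C.a i with hz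
  have hyz : ∀ i, y i = C.a i * z i := fun i => by
    simp only [hz]; field_simp [(ha i).ne']
  set M : Fin (ℓ + 1) → Fin (ℓ + 1) → ℝ := fun i j => C.aCheck i * C.A i j * C.a j with hM
  have hsymm : ∀ i j, M i j = M j i := fun i j => by
    have := C.symmetrized i j
    simp only [hM]; exact_mod_cast this
  have hrow : ∀ i, ∑ j, M i j = 0 := fun i => by
    have : ∑ j, (C.A i j : ℝ) * C.a j = 0 := by exact_mod_cast C.a_null i
    simp only [hM, mul_assoc, ← Finset.mul_sum, this, mul_zero]
  have hMz : ∀ i, ∑ j, M i j * z j = 0 := fun i => by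
    have : ∀ j, M i j * z j = C.aCheck i * ((C.A i j : ℝ) * y j) := fun j => by
      rw [hyz]; simp only [hM]; ring
    simp only [this, ← Finset.mul_sum, hy, mul_zero]
  -- The Dirichlet form of the weights −M at the vector z. Its terms have one sign, so z is constant
  -- along edges, and indecomposability makes it constant.
  have hquad : ∑ i, ∑ j, M i j * (z i - z j) ^ 2 = 0 := by
    have h1 : ∀ i j, M i j * (z i - z j) ^ 2 =
        z i ^ 2 * M i j - 2 * (z i * (M i j * z j)) + M i j * z j ^ 2 := fun i j => by ring
    have h2 : ∑ i, ∑ j, M i j * z j ^ 2 = 0 := by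
      rw [Finset.sum_comm]
      refine Finset.sum_eq_zero fun j _ => ?_
      rw [← Finset.sum_mul, Finset.sum_congr rfl fun i _ => hsymm i j, hrow, zero_mul]
    simp only [h1, Finset.sum_add_distrib, Finset.sum_sub_distrib, ← Finset.mul_sum, hrow, hMz,
      h2, mul_zero, Finset.sum_const_zero, sub_zero, add_zero]
  have hnonpos : ∀ i j, M i j * (z i - z j) ^ 2 ≤ 0 := fun i j => by
    rcases eq_or_ne i j with rfl | hij
    · simp
    · have : (C.A i j : ℝ) ≤ 0 := by exact_mod_cast C.offDiag i j hij
      refine mul_nonpos_of_nonpos_of_nonneg ?_ (sq_nonneg _)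
      exact mul_nonpos_of_nonpos_of_nonneg
        (mul_nonpos_of_nonneg_of_nonpos (hb i).le this) (ha j).le
  have hzero : ∀ i j, M i j * (z i - z j) ^ 2 = 0 := fun i j =>
    (Finset.sum_eq_zero_iff_of_nonpos fun j _ => hnonpos i j).1
      ((Finset.sum_eq_zero_iff_of_nonpos fun i _ => Finset.sum_nonpos fun j _ => hnonpos i j).1
        hquad i (Finset.mem_univ i)) j (Finset.mem_univ j)
  have hconst : ∀ i, z i = z 0 := by
    by_contra! hcon
    obtain ⟨k, hk⟩ := hcon
    obtain ⟨i, hi, j, hj, hij⟩ := C.indecomposable {i | z i = z 0} ⟨0, rfl⟩ ⟨k, hk⟩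
    rcases mul_eq_zero.1 (hzero i j) with h | h
    · simp only [hM, mul_eq_zero, (ha j).ne', (hb i).ne', or_false, false_or] at h
      exact hij (by exact_mod_cast h)
    · refine hj ?_
      have : z i = z j := sub_eq_zero.1 (pow_eq_zero_iff two_ne_zero |>.1 h)
      simpa [this] using hi
  intro i
  have h0 : y 0 = z 0 := by rw [hyz, C.a_zero]; simp
  rw [hyz i, hconst, h0, mul_comm]

/-- The complex kernel of `A` is spanned by the vector `a`. -/
theorem kernel_complex (y : Fin (ℓ + 1) → ℂ) (hy : ∀ i, ∑ j, (C.A i j : ℂ) * y j = 0) :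
    ∀ i, y i = y 0 * C.a i := by
  have hre := C.kernel_real (fun i => (y i).re) fun i => by
    simpa using congrArg Complex.re (hy i)
  have him := C.kernel_real (fun i => (y i).im) fun i => by
    simpa using congrArg Complex.im (hy i)
  intro i
  apply Complex.ext
  · simpa using hre i
  · simpa using him i

/-! ### The pairing and the form on ᴸ𝔥 -/

theorem a_ne_zero (i : Fin (ℓ + 1)) : (C.a i : ℂ) ≠ 0 := Nat.cast_ne_zero.2 (C.a_pos i).ne'

theorem aCheck_ne_zero (i : Fin (ℓ + 1)) : (C.aCheck i : ℂ) ≠ 0 :=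
  Nat.cast_ne_zero.2 (C.aCheck_pos i).ne'

theorem pair_coroot (y : CartanLH ℓ) (i : Fin (ℓ + 1)) :
    C.pair y (coroot i) = ∑ j, (C.A i j : ℂ) * y.1 j + if i = 0 then y.2 else 0 := by
  simp [pair, coroot, Pi.single_apply, Finset.sum_ite_eq, eq_comm]

theorem pair_root_coroot (i j : Fin (ℓ + 1)) : C.pair (root j) (coroot i) = C.A i j := by
  simp [pair_coroot, root, Pi.single_apply]

/-- The pairing as a linear function of its first argument. -/
noncomputable def pairL (x : CartanH ℓ) : CartanLH ℓ →ₗ[ℂ] ℂ where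
  toFun y := C.pair y x
  map_add' y y' := by
    simp only [pair, Prod.fst_add, Prod.snd_add, Pi.add_apply, mul_add, add_mul,
      Finset.sum_add_distrib]
    ring
  map_smul' c y := by
    simp only [pair, Prod.smul_fst, Prod.smul_snd, Pi.smul_apply, smul_eq_mul, RingHom.id_apply,
      mul_add, Finset.mul_sum]
    refine congrArg₂ _ (congrArg₂ _ (Finset.sum_congr rfl fun i _ => Finset.sum_congr rfl fun j _ =>
      by ring) (by ring)) (by ring)

@[simp] theorem pairL_apply (x : CartanH ℓ) (y : CartanLH ℓ) : C.pairL x y = C.pair y x := rfl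

theorem pair_eq_sum (y : CartanLH ℓ) (x : CartanH ℓ) :
    C.pair y x = ∑ i, x.1 i * C.pair y (coroot i) + y.1 0 * x.2 := by
  simp only [pair_coroot, mul_add, Finset.sum_add_distrib]
  simp only [pair, Finset.mul_sum, mul_ite, mul_zero, Finset.sum_ite_eq', Finset.mem_univ, if_true,
    mul_assoc]
  ring

theorem formLH_eq_pair (y y' : CartanLH ℓ) : C.formLH y y' = C.pair y (C.nuInv y') :=
  C.formH_nuInv y _

/-- In the coordinates y_i / a_i the Gram matrix on the roots is ǎ_i A_ij a_j, so this is
`symmetrized`; the cross terms with Λ₀ match because a_0 = ǎ_0 = 1. -/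
theorem formLH_symm (y y' : CartanLH ℓ) : C.formLH y y' = C.formLH y' y := by
  have h : ∀ y y' : CartanLH ℓ, C.formLH y y' = ∑ i, ∑ j,
      (C.aCheck i * C.A i j * C.a j : ℂ) * (y'.1 i / C.a i) * (y.1 j / C.a j) +
        (y.1 0 * y'.2 + y.2 * y'.1 0) := by
    intro y y'
    rw [formLH_eq_pair, pair, add_assoc]
    congr 1
    · refine Finset.sum_congr rfl fun i _ => Finset.sum_congr rfl fun j _ => ?_
      have := C.a_ne_zero i
      have := C.a_ne_zero j
      simp only [nuInv]; field_simp
    · simp [nuInv, C.a_zero, C.aCheck_zero]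
  rw [h, h, Finset.sum_comm]
  congr 1
  · refine Finset.sum_congr rfl fun i _ => Finset.sum_congr rfl fun j _ => ?_
    have : (C.aCheck j * C.A j i * C.a i : ℂ) = C.aCheck i * C.A i j * C.a j := by
      exact_mod_cast C.symmetrized j i
    rw [this]; ring
  · ring

theorem nuInv_root (i : Fin (ℓ + 1)) :
    C.nuInv (root i) = ((C.aCheck i : ℂ) / C.a i) • coroot i := by
  ext k
  · by_cases h : k = i
    · subst h; simp [nuInv, root, coroot]
    · simp [nuInv, root, coroot, h]
  · simp [nuInv, root, coroot]

theorem pair_smul_right (y : CartanLH ℓ) (c : ℂ) (x : CartanH ℓ) :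
    C.pair y (c • x) = c * C.pair y x := by
  rw [pair_eq_sum, C.pair_eq_sum y x]
  simp only [Prod.smul_fst, Prod.smul_snd, Pi.smul_apply, smul_eq_mul, mul_add, Finset.mul_sum]
  refine congrArg₂ _ (Finset.sum_congr rfl fun i _ => by ring) (by ring)

theorem formLH_root (y : CartanLH ℓ) (i : Fin (ℓ + 1)) :
    C.formLH y (root i) = (C.aCheck i : ℂ) / C.a i * C.pair y (coroot i) := by
  rw [formLH_eq_pair, nuInv_root, pair_smul_right]

/-- The form on `ᴸ𝔥` as a bilinear map. -/
noncomputable def formLHBilin : LinearMap.BilinForm ℂ (CartanLH ℓ) :=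
  LinearMap.mk₂ ℂ C.formLH
    (fun y y' w => by simp only [formLH_eq_pair, ← pairL_apply, map_add])
    (fun c y w => by simp only [formLH_eq_pair, ← pairL_apply, map_smul])
    (fun w y y' => by
      rw [C.formLH_symm w, C.formLH_symm w, C.formLH_symm w]
      simp only [formLH_eq_pair, ← pairL_apply, map_add])
    (fun c w y => by
      rw [C.formLH_symm w, C.formLH_symm w]
      simp only [formLH_eq_pair, ← pairL_apply, map_smul])

@[simp] theorem formLHBilin_apply (y y' : CartanLH ℓ) : C.formLHBilin y y' = C.formLH y y' := rfl

theorem delta_eq : C.delta = (fun i => (C.a i : ℂ), 0) := by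
  ext k
  · simp [delta, root, Pi.single_apply, Finset.sum_apply, Prod.fst_sum]
  · simp [delta, root, Prod.snd_sum]

/-- δ corresponds to the central element k of 𝔤. At y = ρ the right side is h^∨, which is nonzero.
-/
theorem formLH_delta (y : CartanLH ℓ) :
    C.formLH y C.delta = ∑ i, (C.aCheck i : ℂ) * C.pair y (coroot i) := by
  rw [delta, ← formLHBilin_apply, map_sum]
  refine Finset.sum_congr rfl fun i _ => ?_
  have := C.a_ne_zero i
  rw [map_smul, formLHBilin_apply, formLH_root, smul_eq_mul]
  field_simp

theorem pair_delta_coroot (i : Fin (ℓ + 1)) : C.pair C.delta (coroot i) = 0 := by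
  rw [pair_coroot, delta_eq]
  have : ∑ j, (C.A i j : ℂ) * C.a j = 0 := by exact_mod_cast C.a_null i
  simp [this]

/-! ### Existence of ρ -/

theorem hDual_pos : 0 < C.hDual :=
  Finset.sum_pos (fun i _ => C.aCheck_pos i) Finset.univ_nonempty

/-- A is singular, so the roots alone do not realise every set of values on the coroots. Tying the
Λ₀-coordinate to the α₀-coordinate gives a square injective system. Subtracting a multiple of δ then
corrects the norm without changing these values, as (ρ|δ) = h^∨ ≠ 0 and (δ|δ) = 0. -/
theorem exists_isRho : ∃ r, C.IsRho r := by
  let T : (Fin (ℓ + 1) → ℂ) →ₗ[ℂ] (Fin (ℓ + 1) → ℂ) :=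
    LinearMap.pi fun i => C.pairL (coroot i) ∘ₗ LinearMap.prod LinearMap.id (LinearMap.proj 0)
  have hT : ∀ y i, T y i = ∑ j, (C.A i j : ℂ) * y j + if i = 0 then y 0 else 0 := fun y i => by
    simp [T, pair_coroot]
  have hinj : Function.Injective T := by
    rw [injective_iff_map_eq_zero]
    intro y hy
    have h : ∀ i, ∑ j, (C.A i j : ℂ) * y j + (if i = 0 then y 0 else 0) = 0 := fun i => by
      rw [← hT, hy]; rfl
    have h0 : y 0 = 0 := by
      -- Pairing the system with ǎ kills the part with A and leaves only ǎ_0 y_0 = y_0.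
      have h1 : ∑ i, (C.aCheck i : ℂ) * (∑ j, (C.A i j : ℂ) * y j + if i = 0 then y 0 else 0) = 0 :=
        Finset.sum_eq_zero fun i _ => by rw [h, mul_zero]
      have h2 : ∑ i, (C.aCheck i : ℂ) * ∑ j, (C.A i j : ℂ) * y j = 0 := by
        simp only [Finset.mul_sum]
        rw [Finset.sum_comm]
        refine Finset.sum_eq_zero fun j _ => ?_
        have : ∑ i, (C.A i j : ℂ) * C.aCheck i = 0 := by exact_mod_cast C.aCheck_null j
        rw [← mul_zero (y j), ← this, Finset.mul_sum]
        exact Finset.sum_congr rfl fun i _ => by ring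
      simpa [mul_add, Finset.sum_add_distrib, h2, C.aCheck_zero] using h1
    have h3 := C.kernel_complex y fun i => by simpa [h0] using h i
    funext i
    rw [h3, h0, zero_mul]; rfl
  obtain ⟨y, hy⟩ := (LinearMap.injective_iff_surjective.1 hinj) fun _ => 1
  set r : CartanLH ℓ := (y, y 0)
  have hr : ∀ i, C.pair r (coroot i) = 1 := fun i => by
    rw [pair_coroot, ← hT, hy]
  have hrd : C.formLHBilin r C.delta = C.hDual := by
    simp [formLH_delta, hr, hDual]
  have hdd : C.formLHBilin C.delta C.delta = 0 := by
    simp [formLH_delta, pair_delta_coroot]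
  have hdr : C.formLHBilin C.delta r = C.hDual := by
    rw [← hrd, formLHBilin_apply, formLH_symm, formLHBilin_apply]
  have hh : (C.hDual : ℂ) ≠ 0 := Nat.cast_ne_zero.2 C.hDual_pos.ne'
  refine ⟨r - (C.formLHBilin r r / (2 * C.hDual)) • C.delta, fun i => ?_, ?_⟩
  · rw [← pairL_apply, map_sub, map_smul, pairL_apply, pairL_apply, hr, pair_delta_coroot]
    simp
  · rw [← formLHBilin_apply]
    simp only [map_sub, map_smul, LinearMap.sub_apply, LinearMap.smul_apply, hrd, hdd, hdr,
      smul_eq_mul]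
    field_simp
    ring

theorem isRho_rho : C.IsRho C.rho := Classical.epsilon_spec C.exists_isRho

theorem pair_rho_coroot (i : Fin (ℓ + 1)) : C.pair C.rho (coroot i) = 1 := C.isRho_rho.1 i

end AffineCartanDatum

/-! ### Invariant forms on graded Lie algebras -/

section GradedInvariance

set_option linter.unusedSectionVars false

variable {K L : Type*} [Field K] [CharZero K] [LieRing L] [LieAlgebra K L]

/-- Cyclic invariance of a bilinear form on three homogeneous components of a graded Lie algebra. -/
def CyclicOn (G : ℤ → Submodule K L) (B : LinearMap.BilinForm K L) (a b c : ℤ) : Prop :=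
  ∀ x ∈ G a, ∀ y ∈ G b, ∀ z ∈ G c, B ⁅x, y⁆ z = B ⁅y, z⁆ x ∧ B ⁅y, z⁆ x = B ⁅z, x⁆ y

theorem lie_skew_form (B : LinearMap.BilinForm K L) (x y z : L) : B ⁅x, y⁆ z = -B ⁅y, x⁆ z := by
  rw [← lie_skew, map_neg, LinearMap.neg_apply]

theorem CyclicOn.rotate {G : ℤ → Submodule K L} {B : LinearMap.BilinForm K L} {a b c : ℤ}
    (h : CyclicOn G B a b c) : CyclicOn G B b c a := fun y hy z hz x hx =>
  ⟨(h x hx y hy z hz).2, (h x hx y hy z hz).2.symm.trans (h x hx y hy z hz).1.symm⟩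

theorem CyclicOn.swap {G : ℤ → Submodule K L} {B : LinearMap.BilinForm K L} {a b c : ℤ}
    (h : CyclicOn G B a b c) : CyclicOn G B b a c := fun y hy x hx z hz => by
  obtain ⟨h1, h2⟩ := h x hx y hy z hz
  rw [lie_skew_form B y x, lie_skew_form B x z, lie_skew_form B z y, h1, h2]
  exact ⟨rfl, rfl⟩

/-- Properties of a symmetric form on a graded Lie algebra which give its invariance in positive
degrees by induction. -/
structure GradedFormData (G : ℤ → Submodule K L) (B : LinearMap.BilinForm K L) (μ : L →ₗ[K] K) :
    Prop where
  lie_mem : ∀ {a b x y}, x ∈ G a → y ∈ G b → ⁅x, y⁆ ∈ G (a + b)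
  pos_gen : ∀ n : ℕ, G (n + 2) ≤
    Submodule.span K {z | ∃ e ∈ G 1, ∃ x ∈ G (n + 1), z = ⁅e, x⁆}
  neg_gen : ∀ n : ℕ, G (-(n + 2)) ≤
    Submodule.span K {z | ∃ e ∈ G (-1), ∃ x ∈ G (-(n + 1)), z = ⁅e, x⁆}
  symm : ∀ x y, B x y = B y x
  form_eq : ∀ {a : ℤ} {x y}, x ∈ G a → y ∈ G (-a) → (a : K) * B x y = μ ⁅x, y⁆

namespace GradedFormData

variable {G : ℤ → Submodule K L} {B : LinearMap.BilinForm K L} {μ : L →ₗ[K] K}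

theorem mem_of_eq {a b : ℤ} {x : L} (hx : x ∈ G a) (h : a = b) : x ∈ G b := h ▸ hx

theorem lie_mem' (D : GradedFormData G B μ) {a b c : ℤ} {x y : L} (hx : x ∈ G a) (hy : y ∈ G b)
    (h : a + b = c) : ⁅x, y⁆ ∈ G c := h ▸ D.lie_mem hx hy

/-- The opposite grading. -/
theorem opposite (D : GradedFormData G B μ) : GradedFormData (fun n => G (-n)) B (-μ) where
  lie_mem hx hy := D.lie_mem' hx hy (by ring)
  pos_gen n := D.neg_gen n
  neg_gen n := by simpa using D.pos_gen n
  symm := D.symm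
  form_eq {a x y} hx hy := by
    have := D.form_eq hx hy
    push_cast at this
    rw [LinearMap.neg_apply, ← this]
    ring

/-- The weighted sum of the three cyclic rotations, from the Jacobi identity. -/
theorem weighted_sum (D : GradedFormData G B μ) {a b c : ℤ} (habc : a + b + c = 0) {x y z : L}
    (hx : x ∈ G a) (hy : y ∈ G b) (hz : z ∈ G c) :
    (c : K) * B ⁅x, y⁆ z + a * B ⁅y, z⁆ x + b * B ⁅z, x⁆ y = 0 := by
  have h1 := D.form_eq (D.lie_mem' hx hy (c := -c) (by linarith)) (mem_of_eq hz (by ring))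
  have h2 := D.form_eq (D.lie_mem' hy hz (c := -a) (by linarith)) (mem_of_eq hx (by ring))
  have h3 := D.form_eq (D.lie_mem' hz hx (c := -b) (by linarith)) (mem_of_eq hy (by ring))
  have hj : ⁅⁅x, y⁆, z⁆ + ⁅⁅y, z⁆, x⁆ + ⁅⁅z, x⁆, y⁆ = 0 := by
    rw [← lie_skew ⁅x, y⁆ z, ← lie_skew ⁅y, z⁆ x, ← lie_skew ⁅z, x⁆ y, ← neg_add, ← neg_add,
      neg_eq_zero, ← lie_jacobi x y z]
    abel
  have := congrArg μ hj
  simp only [map_add, map_zero] at this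
  push_cast at h1 h2 h3
  linear_combination -h1 - h2 - h3 - this

/-- Two rotations that agree, opposite to a component of nonzero degree, agree with the third. -/
theorem cyclic_of_eq (D : GradedFormData G B μ) {a b c : ℤ} (habc : a + b + c = 0) (hb : b ≠ 0)
    {x y z : L} (hx : x ∈ G a) (hy : y ∈ G b) (hz : z ∈ G c) (h : B ⁅x, y⁆ z = B ⁅y, z⁆ x) :
    B ⁅y, z⁆ x = B ⁅z, x⁆ y := by
  have hs := D.weighted_sum habc hx hy hz
  have hb' : (b : K) ≠ 0 := Int.cast_ne_zero.2 hb
  have hc : (c : K) = -(a + b) := by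
    have : c = -(a + b) := by linarith
    rw [this]; push_cast; ring
  apply mul_left_cancel₀ hb'
  rw [h, hc] at hs
  linear_combination -hs

/-! ### Induction on the largest degree -/

variable {N : ℕ}

/-- The inductive step for the degrees `N, 1, -(N + 1)`. -/
theorem step_one (D : GradedFormData G B μ) (hN : 1 ≤ N)
    (ih : ∀ a b c : ℤ, a + b + c = 0 → |a| ≤ N → |b| ≤ N → |c| ≤ N → CyclicOn G B a b c) :
    CyclicOn G B 1 (-(N + 1)) N := by
  intro e he z hz x hx
  suffices h : B ⁅e, z⁆ x = B ⁅z, x⁆ e from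
    ⟨h, D.cyclic_of_eq (by ring) (by omega) he hz hx h⟩
  obtain ⟨n, rfl⟩ : ∃ n, N = n + 1 := ⟨N - 1, by omega⟩
  -- Split the lowest-degree factor as z = [f, w] with f in degree −1. After expanding by the Jacobi
  -- identity, only triples with degrees bounded by N occur.
  have hz' := D.neg_gen n (mem_of_eq hz (by push_cast; ring))
  clear hz
  induction hz' using Submodule.span_induction with
  | zero => simp
  | add u v _ _ hu hv => simp only [lie_add, add_lie, map_add, LinearMap.add_apply, hu, hv]
  | smul c u _ hu => simp only [lie_smul, smul_lie, map_smul, LinearMap.smul_apply, hu]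
  | mem z hz =>
    obtain ⟨f, hf, w, hw, rfl⟩ := hz
    push_cast at *
    have hxf : ⁅x, f⁆ ∈ G n := D.lie_mem' hx hf (by ring)
    have hew : ⁅e, w⁆ ∈ G (-n) := D.lie_mem' he hw (by ring)
    have hef : ⁅e, f⁆ ∈ G 0 := D.lie_mem' he hf (by ring)
    have hwx : ⁅w, x⁆ ∈ G 0 := D.lie_mem' hw hx (by ring)
    have hfx : ⁅f, x⁆ ∈ G n := D.lie_mem' hf hx (by ring)
    have ab : |(n : ℤ)| = n := abs_of_nonneg (by positivity)
    have ab' : |(n : ℤ) + 1| = n + 1 := abs_of_nonneg (by positivity)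
    have c1 := ih (n + 1) (-1) (-n) (by ring) (by simp [ab']) (by simp) (by simp)
      x hx f hf _ hew
    have c2 := ih n 1 (-(n + 1)) (by ring) (by simp) (by simp) (by rw [abs_neg, ab'])
      _ hxf e he w hw
    have c3 := ih (-(n + 1)) n 1 (by ring) (by rw [abs_neg, ab']) (by simp) (by simp)
      w hw _ hfx e he
    have c4 := ih (n + 1) 0 (-(n + 1)) (by ring) (by rw [ab']) (by simp; positivity)
      (by rw [abs_neg, ab']) x hx _ hef w hw
    have c5 := ih (-1) 0 1 (by ring) (by simp) (by simp; positivity) (by simp)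
      f hf _ hwx e he
    rw [leibniz_lie e f w, lie_lie f w x]
    simp only [map_add, map_sub, LinearMap.add_apply, LinearMap.sub_apply]
    have e1 : B ⁅⁅f, x⁆, e⁆ w = -B ⁅⁅x, f⁆, e⁆ w := by
      rw [← lie_skew f x, neg_lie, map_neg, LinearMap.neg_apply]
    linear_combination c4.2 - c1.1 + D.symm ⁅x, f⁆ ⁅e, w⁆ - c2.1 + D.symm ⁅w, x⁆ ⁅e, f⁆ - c5.1 - c5.2
      + c3.1 + e1

/-- The inductive step for the degrees `a, b, -(N + 1)` with `a, b ≥ 0`. -/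
theorem step_pos (D : GradedFormData G B μ) (hN : 1 ≤ N)
    (ih : ∀ a b c : ℤ, a + b + c = 0 → |a| ≤ N → |b| ≤ N → |c| ≤ N → CyclicOn G B a b c)
    (b : ℕ) : ∀ a : ℕ, a + b = N → CyclicOn G B a (b + 1) (-(N + 1)) := by
  induction b with
  | zero =>
    rintro a rfl
    simpa using (D.step_one hN ih).rotate.rotate
  | succ b ihb =>
    intro a hab x hx y hy z hz
    suffices h : B ⁅x, y⁆ z = B ⁅y, z⁆ x from
      ⟨h, D.cyclic_of_eq (by push_cast [← hab]; ring) (by positivity) hx hy hz h⟩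
    -- Writing y = [e, w] with e in degree 1 moves one degree from y to x: the triple with [x, e]
    -- and w is covered by `ihb`, the triple with [x, w] and e by `step_one`.
    have hy' := D.pos_gen b (mem_of_eq hy (by push_cast; ring))
    clear hy
    induction hy' using Submodule.span_induction with
    | zero => simp
    | add u v _ _ hu hv => simp only [lie_add, add_lie, map_add, LinearMap.add_apply, hu, hv]
    | smul c u _ hu => simp only [lie_smul, smul_lie, map_smul, LinearMap.smul_apply, hu]
    | mem y hy =>
      obtain ⟨e, he, w, hw, rfl⟩ := hy
      subst hab
      push_cast at *
      have hez : ⁅e, z⁆ ∈ G (-(a + (b + 1))) := D.lie_mem' he hz (by ring)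
      have hwz : ⁅w, z⁆ ∈ G (-(a + 1)) := D.lie_mem' hw hz (by ring)
      have hxw : ⁅x, w⁆ ∈ G (a + (b + 1)) := D.lie_mem' hx hw (by ring)
      have hxe : ⁅x, e⁆ ∈ G (a + 1) := D.lie_mem' hx he (by ring)
      have c1 := ih a (b + 1) (-(a + (b + 1))) (by ring) (by rw [abs_of_nonneg] <;> omega)
        (by rw [abs_of_nonneg] <;> omega) (by rw [abs_of_nonpos] <;> omega) x hx w hw _ hez
      have c2 := (D.step_one hN ih).rotate.rotate _ (mem_of_eq hxw (by push_cast; ring)) e he z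
        (mem_of_eq hz (by push_cast; ring))
      have c3 := ih a 1 (-(a + 1)) (by ring) (by rw [abs_of_nonneg] <;> omega)
        (by rw [abs_of_nonneg] <;> omega) (by rw [abs_of_nonpos] <;> omega) x hx e he _ hwz
      have c4 := ihb (a + 1) (by ring) _ (by simpa using hxe) w hw z
        (mem_of_eq hz (by ring))
      rw [lie_lie e w z, leibniz_lie x e w, ← lie_skew e ⁅x, w⁆]
      simp only [map_add, map_sub, map_neg, LinearMap.add_apply, LinearMap.sub_apply,
        LinearMap.neg_apply]
      linear_combination c4.1 - c2.1 + c3.1 - c1.1 - D.symm ⁅x, e⁆ ⁅w, z⁆ + D.symm ⁅x, w⁆ ⁅e, z⁆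

theorem cyclicOn_pos (D : GradedFormData G B μ) (hN : 1 ≤ N)
    (ih : ∀ a b c : ℤ, a + b + c = 0 → |a| ≤ N → |b| ≤ N → |c| ≤ N → CyclicOn G B a b c)
    {a b c : ℤ} (ha : 0 ≤ a) (hb : 0 ≤ b) (hab : a + b = N + 1) (hc : c = -(N + 1)) :
    CyclicOn G B a b c := by
  subst hc
  obtain ⟨a, rfl⟩ := Int.eq_ofNat_of_zero_le ha
  obtain ⟨b, rfl⟩ := Int.eq_ofNat_of_zero_le hb
  rcases b with _ | b
  · obtain ⟨a, rfl⟩ : ∃ n, a = n + 1 := ⟨a - 1, by omega⟩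
    simpa using (D.step_pos hN ih a 0 (by omega)).swap
  · simpa using D.step_pos hN ih b a (by omega)

theorem opposite_iff {a b c : ℤ} :
    CyclicOn (fun n => G (-n)) B a b c ↔ CyclicOn G B (-a) (-b) (-c) := Iff.rfl

theorem cyclicOn_neg (D : GradedFormData G B μ) (hN : 1 ≤ N)
    (ih : ∀ a b c : ℤ, a + b + c = 0 → |a| ≤ N → |b| ≤ N → |c| ≤ N → CyclicOn G B a b c)
    {a b c : ℤ} (ha : a ≤ 0) (hb : b ≤ 0) (hab : a + b = -(N + 1)) (hc : c = N + 1) :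
    CyclicOn G B a b c := by
  have := D.opposite.cyclicOn_pos (a := -a) (b := -b) (c := -c) hN
    (fun a b c h ha hb hc => opposite_iff.2 (ih _ _ _ (by linarith) (by rwa [abs_neg])
      (by rwa [abs_neg]) (by rwa [abs_neg]))) (by linarith) (by linarith) (by linarith)
      (by linarith)
  simpa [opposite_iff] using this

/-- A graded symmetric form which is cyclic in degrees at most one is cyclic in all degrees. -/
theorem cyclicOn (D : GradedFormData G B μ)
    (h1 : ∀ a b c : ℤ, a + b + c = 0 → |a| ≤ 1 → |b| ≤ 1 → |c| ≤ 1 → CyclicOn G B a b c)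
    {a b c : ℤ} (habc : a + b + c = 0) : CyclicOn G B a b c := by
  suffices h : ∀ N : ℕ, ∀ a b c : ℤ, a + b + c = 0 → |a| ≤ (N + 1 : ℕ) → |b| ≤ (N + 1 : ℕ) →
      |c| ≤ (N + 1 : ℕ) → CyclicOn G B a b c from
    h (a.natAbs + b.natAbs + c.natAbs) a b c habc (by rw [abs_le]; omega) (by rw [abs_le]; omega)
      (by rw [abs_le]; omega)
  intro N
  induction N with
  | zero => simpa using h1
  | succ N ih =>
    intro a b c h ha hb hc
    rw [abs_le] at ha hb hc
    -- If one degree is extremal, the bounds force the other two to have weakly the opposite sign; a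
    -- rotation brings the extremal one to the last place.
    by_cases hc1 : c = -((N + 1 : ℕ) + 1)
    · exact D.cyclicOn_pos (by omega) ih (by omega) (by omega) (by omega) hc1
    by_cases hc2 : c = (N + 1 : ℕ) + 1
    · exact D.cyclicOn_neg (by omega) ih (by omega) (by omega) (by omega) hc2
    by_cases ha1 : a = -((N + 1 : ℕ) + 1)
    · exact (D.cyclicOn_pos (a := b) (b := c) (by omega) ih (by omega) (by omega) (by omega)
        ha1).rotate.rotate
    by_cases ha2 : a = (N + 1 : ℕ) + 1
    · exact (D.cyclicOn_neg (a := b) (b := c) (by omega) ih (by omega) (by omega) (by omega)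
        ha2).rotate.rotate
    by_cases hb1 : b = -((N + 1 : ℕ) + 1)
    · exact (D.cyclicOn_pos (a := c) (b := a) (by omega) ih (by omega) (by omega) (by omega)
        hb1).rotate
    by_cases hb2 : b = (N + 1 : ℕ) + 1
    · exact (D.cyclicOn_neg (a := c) (b := a) (by omega) ih (by omega) (by omega) (by omega)
        hb2).rotate
    · exact ih a b c h (by rw [abs_le]; omega) (by rw [abs_le]; omega) (by rw [abs_le]; omega)

end GradedFormData

end GradedInvariance

/-! ### Lie algebras generated by Chevalley generators -/

namespace AffineCartanDatum

variable {ℓ : ℕ}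

/-- Elements of a Lie algebra which satisfy the Chevalley relations (but not necessarily the Serre
relations) of `ᴸ𝔤` and generate the Lie algebra. -/
structure ChevalleySystem (C : AffineCartanDatum ℓ) (L : Type*) [LieRing L] [LieAlgebra ℂ L] where
  h : CartanLH ℓ →ₗ[ℂ] L
  e : Fin (ℓ + 1) → L
  f : Fin (ℓ + 1) → L
  lie_h_h : ∀ x y, ⁅h x, h y⁆ = 0
  lie_h_e : ∀ x i, ⁅h x, e i⁆ = C.pair x (coroot i) • e i
  lie_h_f : ∀ x i, ⁅h x, f i⁆ = -(C.pair x (coroot i) • f i)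
  lie_e_f : ∀ i j, ⁅e i, f j⁆ = if i = j then h (root i) else 0
  gen : LieSubalgebra.lieSpan ℂ L (Set.range h ∪ Set.range e ∪ Set.range f) = ⊤

namespace ChevalleySystem

variable {C : AffineCartanDatum ℓ} {L : Type*} [LieRing L] [LieAlgebra ℂ L]
  (S : ChevalleySystem C L)

/-- The system with the roles of `e` and `f` exchanged. -/
def swap : ChevalleySystem C L where
  h := -S.h
  e := S.f
  f := S.e
  lie_h_h x y := by simp [S.lie_h_h]
  lie_h_e x i := by simp [S.lie_h_f]
  lie_h_f x i := by simp [S.lie_h_e]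
  lie_e_f i j := by
    rw [← lie_skew, S.lie_e_f]
    by_cases hij : i = j
    · subst hij; simp
    · simp [hij, Ne.symm hij]
  gen := by
    rw [← S.gen]
    congr 1
    have : Set.range (-S.h) = Set.range S.h := by
      ext x
      constructor
      · rintro ⟨y, rfl⟩; exact ⟨-y, by simp⟩
      · rintro ⟨y, rfl⟩; exact ⟨-y, by simp⟩
    rw [this, Set.union_right_comm]

@[simp] theorem swap_h (y : CartanLH ℓ) : S.swap.h y = -S.h y := rfl

@[simp] theorem swap_e (i : Fin (ℓ + 1)) : S.swap.e i = S.f i := rfl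

theorem swap_swap : S.swap.swap = S := by
  cases S; simp [swap]

/-! ### Iterated brackets of the generators -/

/-- The span of the iterated brackets of `k + 1` of the elements `e i`. -/
def upper : ℕ → Submodule ℂ L
  | 0 => Submodule.span ℂ (Set.range S.e)
  | k + 1 => Submodule.span ℂ {z | ∃ i, ∃ x ∈ upper k, z = ⁅S.e i, x⁆}

theorem e_mem_upper (i : Fin (ℓ + 1)) : S.e i ∈ S.upper 0 :=
  Submodule.subset_span ⟨i, rfl⟩

theorem lie_e_mem_upper (i : Fin (ℓ + 1)) {k : ℕ} {x : L} (hx : x ∈ S.upper k) :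
    ⁅S.e i, x⁆ ∈ S.upper (k + 1) := Submodule.subset_span ⟨i, x, hx, rfl⟩

/-- Induction principle for the spans of iterated brackets. -/
theorem upper_induction {p : ℕ → L → Prop} (h0 : ∀ k, p k 0)
    (hadd : ∀ k x y, p k x → p k y → p k (x + y)) (hsmul : ∀ k (c : ℂ) x, p k x → p k (c • x))
    (he : ∀ i, p 0 (S.e i)) (hlie : ∀ k i, ∀ x ∈ S.upper k, p k x → p (k + 1) ⁅S.e i, x⁆) (k : ℕ) :
    ∀ x ∈ S.upper k, p k x := by
  induction k with
  | zero =>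
    intro x hx
    refine Submodule.span_induction ?_ (h0 0) (fun _ _ _ _ => hadd 0 _ _)
      (fun c _ _ => hsmul 0 c _) hx
    rintro _ ⟨i, rfl⟩; exact he i
  | succ k ih =>
    intro x hx
    refine Submodule.span_induction ?_ (h0 _) (fun _ _ _ _ => hadd _ _ _)
      (fun c _ _ => hsmul _ c _) hx
    rintro _ ⟨i, x, hx, rfl⟩; exact hlie k i x hx (ih x hx)

theorem lie_h_mem_upper (y : CartanLH ℓ) {k : ℕ} {x : L} (hx : x ∈ S.upper k) :
    ⁅S.h y, x⁆ ∈ S.upper k := by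
  refine S.upper_induction (p := fun k x => ⁅S.h y, x⁆ ∈ S.upper k) (fun k => by simp)
    (fun k x x' hx hx' => by rw [lie_add]; exact add_mem hx hx')
    (fun k c x hx => by rw [lie_smul]; exact Submodule.smul_mem _ _ hx) (fun i => ?_)
    (fun k i x hx ih => ?_) k x hx
  · rw [S.lie_h_e]; exact Submodule.smul_mem _ _ (S.e_mem_upper i)
  · rw [leibniz_lie, S.lie_h_e, smul_lie]
    exact add_mem (Submodule.smul_mem _ _ (S.lie_e_mem_upper i hx)) (S.lie_e_mem_upper i ih)

/-- ρ takes the value 1 on every simple root α̌_i of ᴸ𝔤, so ad ρ counts generators. The shift by one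
is that of the index of `upper`. -/
theorem lie_h_rho_upper (k : ℕ) {x : L} (hx : x ∈ S.upper k) :
    ⁅S.h C.rho, x⁆ = ((k : ℂ) + 1) • x := by
  refine S.upper_induction (p := fun k x => ⁅S.h C.rho, x⁆ = ((k : ℂ) + 1) • x) (fun k => by simp)
    (fun k x x' hx hx' => by rw [lie_add, hx, hx', smul_add])
    (fun k c x hx => by rw [lie_smul, hx, smul_comm]) (fun i => ?_) (fun k i x hx ih => ?_) k x hx
  · rw [S.lie_h_e, C.pair_rho_coroot]; simp
  · rw [leibniz_lie, S.lie_h_e, C.pair_rho_coroot, ih, lie_smul, one_smul]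
    push_cast
    module

theorem lie_f_e (i j : Fin (ℓ + 1)) : ⁅S.f i, S.e j⁆ = if i = j then -S.h (root i) else 0 :=
  S.swap.lie_e_f i j

theorem lie_f_upper_zero (i : Fin (ℓ + 1)) {x : L} (hx : x ∈ S.upper 0) :
    ⁅S.f i, x⁆ ∈ LinearMap.range S.h := by
  refine Submodule.span_induction ?_ (by simp) (fun x y _ _ hx hy => ?_) (fun c x _ hx => ?_) hx
  · rintro _ ⟨j, rfl⟩
    rw [S.lie_f_e]
    split_ifs
    · exact ⟨-root i, by simp⟩
    · exact zero_mem _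
  · rw [lie_add]; exact add_mem hx hy
  · rw [lie_smul]; exact Submodule.smul_mem _ _ hx

theorem lie_e_h_mem (i : Fin (ℓ + 1)) {x : L} (hx : x ∈ LinearMap.range S.h) :
    ⁅S.e i, x⁆ ∈ S.upper 0 := by
  obtain ⟨y, rfl⟩ := hx
  rw [← lie_skew, S.lie_h_e]
  exact neg_mem (Submodule.smul_mem _ _ (S.e_mem_upper i))

/-- Moving f_i past e_j leaves a term in ᴸ𝔥, which preserves each span. So lowering never leaves the
nested brackets of the e_j until degree 0 is reached; the Serre relations are not needed. -/
theorem lie_f_upper_succ (i : Fin (ℓ + 1)) (k : ℕ) : ∀ x ∈ S.upper (k + 1),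
    ⁅S.f i, x⁆ ∈ S.upper k := by
  have key : ∀ k, ∀ j, ∀ x ∈ S.upper k, ⁅S.e j, ⁅S.f i, x⁆⁆ ∈ S.upper k →
      ⁅S.f i, ⁅S.e j, x⁆⁆ ∈ S.upper k := by
    intro k j x hx h
    rw [leibniz_lie]
    refine add_mem ?_ h
    rw [S.lie_f_e]
    split_ifs
    · rw [neg_lie]; exact neg_mem (S.lie_h_mem_upper _ hx)
    · simp
  induction k with
  | zero =>
    intro x hx
    refine Submodule.span_induction ?_ (by simp) (fun x y _ _ hx hy => ?_) (fun c x _ hx => ?_) hx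
    · rintro _ ⟨j, x, hx, rfl⟩
      exact key 0 j x hx (S.lie_e_h_mem j (S.lie_f_upper_zero i hx))
    · rw [lie_add]; exact add_mem hx hy
    · rw [lie_smul]; exact Submodule.smul_mem _ _ hx
  | succ k ih =>
    intro x hx
    refine Submodule.span_induction ?_ (by simp) (fun x y _ _ hx hy => ?_) (fun c x _ hx => ?_) hx
    · rintro _ ⟨j, x, hx, rfl⟩
      exact key _ j x hx (S.lie_e_mem_upper j (ih x hx))
    · rw [lie_add]; exact add_mem hx hy
    · rw [lie_smul]; exact Submodule.smul_mem _ _ hx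

/-! ### The principal gradation as the eigenspaces of ad ρ -/

/-- The homogeneous components of the principal gradation. -/
def component : ℤ → Submodule ℂ L
  | .ofNat 0 => LinearMap.range S.h
  | .ofNat (k + 1) => S.upper k
  | .negSucc k => S.swap.upper k

theorem component_succ (k : ℕ) : S.component (k + 1) = S.upper k := rfl

theorem component_one : S.component 1 = Submodule.span ℂ (Set.range S.e) := rfl

theorem component_neg_succ (k : ℕ) : S.component (-(k + 1)) = S.swap.upper k := by
  rw [← Int.negSucc_eq]; rfl

theorem component_neg_one : S.component (-1) = Submodule.span ℂ (Set.range S.f) := rfl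

theorem range_swap_h : LinearMap.range S.swap.h = LinearMap.range S.h := by
  ext x
  constructor
  · rintro ⟨y, rfl⟩; exact ⟨-y, by simp⟩
  · rintro ⟨y, rfl⟩; exact ⟨-y, by simp⟩

theorem component_swap (n : ℤ) : S.swap.component n = S.component (-n) := by
  rcases n with (_ | k) | k
  · exact S.range_swap_h
  · exact (S.component_neg_succ k).symm
  · change S.swap.swap.upper k = S.upper k
    rw [swap_swap]

theorem lie_e_mem_component (i : Fin (ℓ + 1)) (n : ℤ) {x : L} (hx : x ∈ S.component n) :
    ⁅S.e i, x⁆ ∈ S.component (n + 1) := by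
  rcases n with (_ | k) | (_ | k)
  · exact S.lie_e_h_mem i hx
  · exact S.lie_e_mem_upper i hx
  · have := S.swap.lie_f_upper_zero i hx
    rwa [range_swap_h] at this
  · have : Int.negSucc (k + 1) + 1 = Int.negSucc k := by omega
    rw [this]
    exact S.swap.lie_f_upper_succ i k x hx

theorem lie_f_mem_component (i : Fin (ℓ + 1)) (n : ℤ) {x : L} (hx : x ∈ S.component n) :
    ⁅S.f i, x⁆ ∈ S.component (n - 1) := by
  have := S.swap.lie_e_mem_component i (-n) (x := x) (by rwa [component_swap, neg_neg])
  rwa [component_swap, swap_e, neg_add, neg_neg, ← sub_eq_add_neg] at this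

theorem lie_h_mem_component (y : CartanLH ℓ) (n : ℤ) {x : L} (hx : x ∈ S.component n) :
    ⁅S.h y, x⁆ ∈ S.component n := by
  rcases n with (_ | k) | k
  · obtain ⟨z, rfl⟩ := hx
    rw [S.lie_h_h]; exact zero_mem _
  · exact S.lie_h_mem_upper y hx
  · have := S.swap.lie_h_mem_upper (-y) hx
    rwa [swap_h, map_neg, neg_neg] at this

theorem lie_h_rho_component (n : ℤ) {x : L} (hx : x ∈ S.component n) :
    ⁅S.h C.rho, x⁆ = (n : ℂ) • x := by
  rcases n with (_ | k) | k
  · obtain ⟨z, rfl⟩ := hx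
    rw [S.lie_h_h]; simp
  · simpa using S.lie_h_rho_upper k hx
  · have := S.swap.lie_h_rho_upper k hx
    rw [swap_h, neg_lie, neg_eq_iff_eq_neg] at this
    rw [this, Int.cast_negSucc]
    push_cast
    module

/-- The elements whose adjoint action preserves the sum W form a subalgebra containing the
generators, hence everything. So W is itself a subalgebra, and it contains the generators. -/
theorem iSup_component : ⨆ n, S.component n = ⊤ := by
  set W := ⨆ n, S.component n with hW
  have hle : ∀ n, S.component n ≤ W := le_iSup _
  have hstable : ∀ x : L, ∀ w ∈ W, ⁅x, w⁆ ∈ W := by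
    let T : LieSubalgebra ℂ L :=
      { carrier := {x | ∀ w ∈ W, ⁅x, w⁆ ∈ W}
        add_mem' := fun hx hy w hw => by rw [add_lie]; exact add_mem (hx w hw) (hy w hw)
        zero_mem' := fun w _ => by rw [zero_lie]; exact zero_mem _
        smul_mem' := fun c x hx w hw => by rw [smul_lie]; exact Submodule.smul_mem _ _ (hx w hw)
        lie_mem' := fun {x y} hx hy w hw => by
          rw [lie_lie]; exact sub_mem (hx _ (hy w hw)) (hy _ (hx w hw)) }
    have hT : LieSubalgebra.lieSpan ℂ L (Set.range S.h ∪ Set.range S.e ∪ Set.range S.f) ≤ T := by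
      rw [LieSubalgebra.lieSpan_le]
      have hind : ∀ x : L, (∀ n, ∀ w ∈ S.component n, ⁅x, w⁆ ∈ W) → ∀ w ∈ W, ⁅x, w⁆ ∈ W := by
        intro x hx w hw
        refine Submodule.iSup_induction _ (motive := fun w => ⁅x, w⁆ ∈ W) hw hx (by simp) ?_
        intro u v hu hv
        rw [lie_add]; exact add_mem hu hv
      rintro _ ((⟨y, rfl⟩ | ⟨i, rfl⟩) | ⟨i, rfl⟩)
      · exact hind _ fun n w hw => hle n (S.lie_h_mem_component y n hw)
      · exact hind _ fun n w hw => hle _ (S.lie_e_mem_component i n hw)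
      · exact hind _ fun n w hw => hle _ (S.lie_f_mem_component i n hw)
    rw [S.gen] at hT
    exact fun x => hT (LieSubalgebra.mem_top x)
  let T : LieSubalgebra ℂ L := { W with lie_mem' := fun {x y} _ hy => hstable x y hy }
  have hT : LieSubalgebra.lieSpan ℂ L (Set.range S.h ∪ Set.range S.e ∪ Set.range S.f) ≤ T := by
    rw [LieSubalgebra.lieSpan_le]
    rintro _ ((⟨y, rfl⟩ | ⟨i, rfl⟩) | ⟨i, rfl⟩)
    · exact hle 0 (LinearMap.mem_range_self S.h y)
    · exact hle 1 (S.e_mem_upper i)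
    · exact hle (-1) (by rw [component_neg_one]; exact Submodule.subset_span ⟨i, rfl⟩)
  rw [S.gen] at hT
  exact eq_top_iff.2 fun x _ => hT (LieSubalgebra.mem_top x)

theorem component_le_eigenspace (n : ℤ) :
    S.component n ≤ Module.End.eigenspace (LieAlgebra.ad ℂ L (S.h C.rho)) (n : ℂ) := fun x hx => by
  rw [Module.End.mem_eigenspace_iff, LieAlgebra.ad_apply, S.lie_h_rho_component n hx]

theorem iSupIndep_eigenspace : iSupIndep fun n : ℤ =>
    Module.End.eigenspace (LieAlgebra.ad ℂ L (S.h C.rho)) (n : ℂ) :=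
  (Module.End.eigenspaces_iSupIndep _).comp Int.cast_injective

/-- The components are the eigenspaces of `ad ρ` with integral eigenvalues. -/
theorem component_eq_eigenspace (n : ℤ) :
    S.component n = Module.End.eigenspace (LieAlgebra.ad ℂ L (S.h C.rho)) (n : ℂ) := by
  refine le_antisymm (S.component_le_eigenspace n) ?_
  set E := fun n : ℤ => Module.End.eigenspace (LieAlgebra.ad ℂ L (S.h C.rho)) (n : ℂ) with hE
  change E n ≤ _
  have h1 : S.component n ⊔ ⨆ k, ⨆ (_ : k ≠ n), E k = ⊤ := by
    rw [eq_top_iff, ← S.iSup_component]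
    refine iSup_le fun k => ?_
    rcases eq_or_ne k n with rfl | hk
    · exact le_sup_left
    · exact le_sup_of_le_right (le_iSup₂_of_le k hk (S.component_le_eigenspace k))
  -- By the modular law and the independence of eigenspaces, a component cannot be smaller than its
  -- eigenspace when the components span.
  have h2 := sup_inf_assoc_of_le (⨆ k, ⨆ (_ : k ≠ n), E k) (S.component_le_eigenspace n)
  rw [h1, top_inf_eq, inf_comm, (S.iSupIndep_eigenspace n).eq_bot, sup_bot_eq] at h2
  exact h2.le

theorem mem_component_iff {n : ℤ} {x : L} :
    x ∈ S.component n ↔ ⁅S.h C.rho, x⁆ = (n : ℂ) • x := by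
  rw [component_eq_eigenspace, Module.End.mem_eigenspace_iff, LieAlgebra.ad_apply]

theorem lie_mem_component {a b : ℤ} {x y : L} (hx : x ∈ S.component a) (hy : y ∈ S.component b) :
    ⁅x, y⁆ ∈ S.component (a + b) := by
  rw [mem_component_iff] at *
  rw [leibniz_lie, hx, hy, smul_lie, lie_smul, ← add_smul, Int.cast_add]

theorem isInternal_component : DirectSum.IsInternal S.component := by
  rw [DirectSum.isInternal_submodule_iff_iSupIndep_and_iSup_eq_top]
  refine ⟨?_, S.iSup_component⟩
  have : S.component = fun n : ℤ =>
    Module.End.eigenspace (LieAlgebra.ad ℂ L (S.h C.rho)) (n : ℂ) :=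
    funext S.component_eq_eigenspace
  rw [this]; exact S.iSupIndep_eigenspace

/-- The linear map which acts on the component of degree `n` by the scalar `c n`. -/
theorem exists_diagonal (c : ℤ → ℂ) : ∃ T : L →ₗ[ℂ] L, ∀ n, ∀ x ∈ S.component n, T x = c n • x := by
  let φ := LinearEquiv.ofBijective (DirectSum.coeLinearMap S.component) S.isInternal_component
  refine ⟨DirectSum.toModule ℂ ℤ L (fun n => c n • (S.component n).subtype) ∘ₗ φ.symm.toLinearMap,
    fun n x hx => ?_⟩
  have : φ.symm x = DirectSum.lof ℂ ℤ (fun n => S.component n) n ⟨x, hx⟩ := by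
    rw [LinearEquiv.symm_apply_eq]
    exact (DirectSum.coeLinearMap_lof S.component n ⟨x, hx⟩).symm
  rw [LinearMap.comp_apply, LinearEquiv.coe_coe, this, DirectSum.toModule_lof]
  simp

theorem induction_on {p : L → Prop} (hp : ∀ n, ∀ x ∈ S.component n, p x) (h0 : p 0)
    (hadd : ∀ x y, p x → p y → p (x + y)) (x : L) : p x :=
  Submodule.iSup_induction S.component (motive := p) (by rw [S.iSup_component]; trivial) hp h0 hadd

/-! #### The invariant form -/

/-- The linear form on `ᴸ𝔥` with value `(ě_i | f̌_i)` on `α_i`. -/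
noncomputable def scale (C : AffineCartanDatum ℓ) : CartanLH ℓ →ₗ[ℂ] ℂ :=
  ∑ i, ((C.aCheck i : ℂ) / C.a i) • (LinearMap.proj i ∘ₗ LinearMap.fst ℂ _ _)

theorem scale_root (i : Fin (ℓ + 1)) : scale C (root i) = (C.aCheck i : ℂ) / C.a i := by
  simp [scale, root, Pi.single_apply]

/-- For x of degree n ≠ 0, invariance forces n(x|y) = ([ρ, x]|y) = (ρ|[x, y]). The functional μ
below agrees with (ρ|p(·)) on the span of the roots, so n⁻¹μ([x, y]) is the only candidate there,
and the given form is used in degree 0. Invariance then has to be checked only in degrees −1, 0, 1.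
-/
theorem exists_form (p : L →ₗ[ℂ] CartanLH ℓ) (hph : ∀ y, p (S.h y) = y)
    (hp : ∀ y x, p ⁅S.h y, x⁆ = 0) :
    ∃ B : LinearMap.BilinForm ℂ L, (∀ x y, B x y = B y x) ∧ (∀ x y z, B ⁅x, y⁆ z = B x ⁅y, z⁆) ∧
      (∀ y y', B (S.h y) (S.h y') = C.formLH y y') ∧
      ∀ a b : ℤ, a + b ≠ 0 → ∀ x ∈ S.component a, ∀ y ∈ S.component b, B x y = 0 := by
  -- As 0⁻¹ = 0, T kills degree 0, so the two summands of B do not overlap.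
  obtain ⟨T, hT⟩ := S.exists_diagonal fun n => (n : ℂ)⁻¹
  set μ : L →ₗ[ℂ] ℂ := scale C ∘ₗ p with hμ
  have hp0 : ∀ n : ℤ, n ≠ 0 → ∀ x ∈ S.component n, p x = 0 := by
    intro n hn x hx
    have h := hp C.rho x
    rw [S.lie_h_rho_component n hx, map_smul, smul_eq_zero] at h
    exact h.resolve_left (Int.cast_ne_zero.2 hn)
  let B : LinearMap.BilinForm ℂ L := LinearMap.mk₂ ℂ
    (fun x y => C.formLHBilin (p x) (p y) + μ ⁅T x, y⁆)
    (fun x x' y => by simp only [map_add, add_lie, LinearMap.add_apply]; ring)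
    (fun c x y => by
      simp only [map_smul, smul_lie, LinearMap.smul_apply, smul_eq_mul]; ring)
    (fun x y y' => by simp only [map_add, lie_add]; ring)
    (fun c x y => by simp only [map_smul, lie_smul, smul_eq_mul]; ring)
  have hB : ∀ x y, B x y = C.formLHBilin (p x) (p y) + μ ⁅T x, y⁆ := fun x y => rfl
  have horth : ∀ a b : ℤ, a + b ≠ 0 → ∀ x ∈ S.component a, ∀ y ∈ S.component b, B x y = 0 := by
    intro a b hab x hx y hy
    rw [hB, hT a x hx, smul_lie, map_smul, hμ, LinearMap.comp_apply,
      hp0 _ hab _ (S.lie_mem_component hx hy), map_zero, smul_zero, add_zero]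
    rcases eq_or_ne a 0 with rfl | ha
    · rw [hp0 b (by simpa using hab) y hy, map_zero]
    · rw [hp0 a ha x hx, map_zero, LinearMap.zero_apply]
  have hne : ∀ a : ℤ, a ≠ 0 → ∀ x ∈ S.component a, ∀ y, B x y = (a : ℂ)⁻¹ * μ ⁅x, y⁆ := by
    intro a ha x hx y
    rw [hB, hT a x hx, smul_lie, map_smul, hp0 a ha x hx, map_zero, LinearMap.zero_apply, zero_add,
      smul_eq_mul]
  have hform : ∀ y y', B (S.h y) (S.h y') = C.formLH y y' := by
    intro y y'
    rw [hB, hT 0 (S.h y) ⟨y, rfl⟩]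
    simp [hph]
  have hsymm : ∀ x y, B x y = B y x := by
    intro x y
    refine S.induction_on (p := fun x => B x y = B y x) (fun a x hx => ?_) (by simp)
      (fun x x' h h' => by rw [map_add, map_add, LinearMap.add_apply, h, h']) x
    refine S.induction_on (p := fun y => B x y = B y x) (fun b y hy => ?_) (by simp)
      (fun x x' h h' => by rw [map_add, map_add, LinearMap.add_apply, h, h']) y
    by_cases hab : a + b = 0
    · obtain rfl : b = -a := by omega
      rcases eq_or_ne a 0 with rfl | ha
      · obtain ⟨x, rfl⟩ := hx
        obtain ⟨y, rfl⟩ := hy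
        rw [hform, hform, formLH_symm]
      · rw [hne a ha x hx, hne (-a) (neg_ne_zero.2 ha) y hy, ← lie_skew x y, map_neg]
        push_cast
        rw [inv_neg]; ring
    · rw [horth a b hab x hx y hy, horth b a (by rwa [add_comm]) y hy x hx]
  have D : GradedFormData S.component B μ :=
    { lie_mem := S.lie_mem_component
      pos_gen := by
        intro n
        have h : S.component (n + 2) = S.upper (n + 1) := by
          rw [← component_succ]; congr 1
        rw [h, component_succ]
        refine Submodule.span_mono ?_
        rintro _ ⟨i, x, hx, rfl⟩
        exact ⟨S.e i, S.e_mem_upper i, x, hx, rfl⟩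
      neg_gen := by
        intro n
        have h : S.component (-(n + 2)) = S.swap.upper (n + 1) := by
          rw [← component_neg_succ]; congr 1
        rw [h, component_neg_succ]
        refine Submodule.span_mono ?_
        rintro _ ⟨i, x, hx, rfl⟩
        exact ⟨S.f i, S.swap.e_mem_upper i, x, hx, rfl⟩
      symm := hsymm
      form_eq := by
        intro a x y hx hy
        rcases eq_or_ne a 0 with rfl | ha
        · obtain ⟨x, rfl⟩ := hx
          obtain ⟨y, rfl⟩ := hy
          simp [S.lie_h_h]
        · rw [hne a ha x hx]
          field_simp [(Int.cast_ne_zero.2 ha : (a : ℂ) ≠ 0)] }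
  have hef : ∀ i j, B (S.e i) (S.f j) = if i = j then (C.aCheck i : ℂ) / C.a i else 0 := by
    intro i j
    rw [hne 1 one_ne_zero _ (S.e_mem_upper i), S.lie_e_f]
    split_ifs <;> simp [hμ, hph, scale_root]
  have c0 : CyclicOn S.component B 0 0 0 := by
    rintro _ ⟨x, rfl⟩ _ ⟨y, rfl⟩ _ ⟨z, rfl⟩
    simp [S.lie_h_h]
  have c1 : CyclicOn S.component B 0 1 (-1) := by
    rintro x hx y hy z hz
    suffices h : B ⁅x, y⁆ z = B ⁅y, z⁆ x from
      ⟨h, D.cyclic_of_eq (by norm_num) one_ne_zero hx hy hz h⟩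
    obtain ⟨w, rfl⟩ := hx
    rw [component_one] at hy
    rw [component_neg_one] at hz
    induction hy using Submodule.span_induction with
    | zero => simp
    | add u v _ _ hu hv => simp only [lie_add, add_lie, map_add, LinearMap.add_apply, hu, hv]
    | smul c u _ hu => simp only [lie_smul, smul_lie, map_smul, LinearMap.smul_apply, hu]
    | mem y hy =>
      obtain ⟨i, rfl⟩ := hy
      induction hz using Submodule.span_induction with
      | zero => simp
      | add u v _ _ hu hv => simp only [lie_add, map_add, LinearMap.add_apply, hu, hv]
      | smul c u _ hu => simp only [lie_smul, map_smul, LinearMap.smul_apply, hu]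
      | mem z hz =>
        obtain ⟨j, rfl⟩ := hz
        rw [S.lie_h_e, map_smul, LinearMap.smul_apply, hef, S.lie_e_f]
        split_ifs with hij
        · rw [hform, formLH_symm, formLH_root, smul_eq_mul, mul_comm]
        · simp
  have hcyc : ∀ a b c : ℤ, a + b + c = 0 → CyclicOn S.component B a b c := by
    intro a b c habc
    refine D.cyclicOn (fun a b c h ha hb hc => ?_) habc
    rw [abs_le] at ha hb hc
    obtain ⟨ha1, ha2⟩ := ha
    obtain ⟨hb1, hb2⟩ := hb
    obtain rfl : c = -a - b := by omega
    -- Up to permutation, the only triples in {−1, 0, 1} of sum zero are (0, 0, 0) and (0, 1, −1).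
    interval_cases a <;> interval_cases b <;> first
      | exact c0 | exact c1 | exact c1.rotate | exact c1.rotate.rotate
      | exact c1.swap | exact c1.swap.rotate | exact c1.swap.rotate.rotate
      | (exfalso; omega)
  refine ⟨B, hsymm, fun x y z => ?_, hform, horth⟩
  refine S.induction_on (p := fun x => B ⁅x, y⁆ z = B x ⁅y, z⁆) (fun a x hx => ?_) (by simp)
    (fun x x' h h' => by simp only [add_lie, map_add, LinearMap.add_apply, h, h']) x
  refine S.induction_on (p := fun y => B ⁅x, y⁆ z = B x ⁅y, z⁆) (fun b y hy => ?_) (by simp)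
    (fun x x' h h' => by simp only [add_lie, lie_add, map_add, LinearMap.add_apply, h, h']) y
  refine S.induction_on (p := fun z => B ⁅x, y⁆ z = B x ⁅y, z⁆) (fun c z hz => ?_) (by simp)
    (fun x x' h h' => by simp only [lie_add, map_add, h, h']) z
  by_cases h : a + b + c = 0
  · rw [(hcyc a b c h x hx y hy z hz).1, hsymm]
  · rw [horth (a + b) c h _ (S.lie_mem_component hx hy) z hz,
      horth a (b + c) (by rwa [← add_assoc]) x hx _ (S.lie_mem_component hy hz)]

/-! #### The Serre elements -/

/-- The iterated brackets `(ad e_i)^n e_j`. -/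
noncomputable def string (i j : Fin (ℓ + 1)) (n : ℕ) : L := (LieAlgebra.ad ℂ L (S.e i) ^ n) (S.e j)

theorem string_zero (i j : Fin (ℓ + 1)) : S.string i j 0 = S.e j := by simp [string]

theorem string_succ (i j : Fin (ℓ + 1)) (n : ℕ) :
    S.string i j (n + 1) = ⁅S.e i, S.string i j n⁆ := by
  simp [string, pow_succ']

theorem string_mem (i j : Fin (ℓ + 1)) (n : ℕ) : S.string i j n ∈ S.upper n := by
  induction n with
  | zero => rw [string_zero]; exact S.e_mem_upper j
  | succ n ih => rw [string_succ]; exact S.lie_e_mem_upper i ih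

theorem lie_h_string (i j : Fin (ℓ + 1)) (n : ℕ) :
    ⁅S.h (root i), S.string i j n⁆ = ((C.A j i : ℂ) + 2 * n) • S.string i j n := by
  induction n with
  | zero => rw [string_zero, S.lie_h_e, pair_root_coroot]; simp
  | succ n ih =>
    rw [string_succ, leibniz_lie, ih, S.lie_h_e, pair_root_coroot, C.diag, smul_lie, lie_smul]
    push_cast
    module

/-- The usual sl₂ computation. The coefficient vanishes for n = −A_ji, which is where the Serre
element sits. -/
theorem lie_f_string_self {i j : Fin (ℓ + 1)} (hij : i ≠ j) (n : ℕ) :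
    ⁅S.f i, S.string i j (n + 1)⁆ = (-((n + 1) * ((C.A j i : ℂ) + n))) • S.string i j n := by
  induction n with
  | zero =>
    rw [string_succ, leibniz_lie, S.lie_f_e, if_pos rfl, neg_lie, lie_h_string, string_zero,
      S.lie_f_e, if_neg hij]
    simp
  | succ n ih =>
    rw [string_succ, leibniz_lie, ih, S.lie_f_e, if_pos rfl, neg_lie, lie_h_string, lie_smul,
      ← string_succ]
    push_cast
    module

/-- For k = i the sl₂ coefficient vanishes. For k = j, [f_j, [e_i, e_j]] is A_ij e_i, which a
further ad e_i kills; if there is no further one, then A_ji = 0 and so A_ij = 0. Any other f_k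
commutes with e_i and e_j. -/
theorem lie_f_serre {i j : Fin (ℓ + 1)} (hij : i ≠ j) (k : Fin (ℓ + 1)) :
    ⁅S.f k, S.string i j (1 - C.A j i).toNat⁆ = 0 := by
  have hA := C.offDiag j i hij.symm
  obtain ⟨n, hn⟩ : ∃ n : ℕ, C.A j i = -n := ⟨(-C.A j i).toNat, by omega⟩
  have hm : (1 - C.A j i).toNat = n + 1 := by omega
  rw [hm]
  by_cases hki : k = i
  · subst hki
    rw [lie_f_string_self S hij, hn]; simp
  have hstep : ∀ n, ⁅S.f k, S.string i j (n + 1)⁆ = ⁅S.e i, ⁅S.f k, S.string i j n⁆⁆ := fun n => by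
    rw [string_succ, leibniz_lie, S.lie_f_e, if_neg hki, zero_lie, zero_add]
  by_cases hkj : k = j
  · subst hkj
    have h1 : ⁅S.f k, S.string i k 1⁆ = (C.A i k : ℂ) • S.e i := by
      rw [hstep, string_zero, S.lie_f_e, if_pos rfl, lie_neg, lie_skew, S.lie_h_e,
        pair_root_coroot]
    rcases n with _ | n
    · rw [h1, C.zero_symm k i (by simpa using hn)]; simp
    · clear hn hm
      induction n with
      | zero => rw [hstep, h1]; simp
      | succ n ih => rw [hstep, ih, lie_zero]
  · clear hn hm
    have h0 : ⁅S.f k, S.string i j 0⁆ = 0 := by rw [string_zero, S.lie_f_e, if_neg hkj]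
    induction n with
    | zero => rw [hstep, h0, lie_zero]
    | succ n ih => rw [hstep, ih, lie_zero]

/-- The Serre elements lie in the radical of a graded invariant form. -/
theorem serre_mem_radical (B : LinearMap.BilinForm ℂ L) (hinv : ∀ x y z, B ⁅x, y⁆ z = B x ⁅y, z⁆)
    (horth : ∀ a b : ℤ, a + b ≠ 0 → ∀ x ∈ S.component a, ∀ y ∈ S.component b, B x y = 0)
    {i j : Fin (ℓ + 1)} (hij : i ≠ j) (y : L) : B (S.string i j (1 - C.A j i).toNat) y = 0 := by
  have hA := C.offDiag j i hij.symm
  obtain ⟨n, hn⟩ : ∃ n : ℕ, (1 - C.A j i).toNat = n + 1 := ⟨(-C.A j i).toNat, by omega⟩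
  have hθ := S.lie_f_serre hij
  rw [hn] at hθ ⊢
  refine S.induction_on (p := fun y => B (S.string i j (n + 1)) y = 0) (fun b y hy => ?_) (by simp)
    (fun x x' h h' => by rw [map_add, h, h', add_zero]) y
  have hmem : S.string i j (n + 1) ∈ S.component ((n + 1 : ℕ) + 1) := S.string_mem i j (n + 1)
  by_cases hb : ((n + 1 : ℕ) + 1 : ℤ) + b = 0
  · obtain rfl : b = -((n + 1 : ℕ) + 1) := by omega
    rw [component_neg_succ] at hy
    refine Submodule.span_induction ?_ (by simp) (fun x y _ _ hx hy => ?_) (fun c x _ hx => ?_) hy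
    -- The opposite component is spanned by brackets [f_k, w], and (θ|[f_k, w]) = ([θ, f_k]|w) = 0
    -- for the Serre element θ.
    · rintro _ ⟨k, w, -, rfl⟩
      rw [← hinv, swap_e, ← lie_skew, hθ k, neg_zero, map_zero, LinearMap.zero_apply]
    · rw [map_add, hx, hy, add_zero]
    · rw [map_smul, hx, smul_zero]
  · exact horth _ _ hb _ hmem y hy

end ChevalleySystem

end AffineCartanDatum

/-! ### The invariant form on `ᴸ𝔤` -/

namespace AffineCartanDatum

variable {ℓ : ℕ} (C : AffineCartanDatum ℓ)

/-- The relators of `ᴸ𝔤` other than the Serre relators. -/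
inductive IsChevalleyRelator : FreeLieAlgebra ℂ (LGen ℓ) → Prop
  | h_add (x y : CartanLH ℓ) : IsChevalleyRelator (freeH (x + y) - (freeH x + freeH y))
  | h_smul (c : ℂ) (x : CartanLH ℓ) : IsChevalleyRelator (freeH (c • x) - c • freeH x)
  | h_h (x y : CartanLH ℓ) : IsChevalleyRelator ⁅freeH x, freeH y⁆
  | h_e (x : CartanLH ℓ) (i : Fin (ℓ + 1)) :
      IsChevalleyRelator (⁅freeH x, freeE i⁆ - C.pair x (coroot i) • freeE i)
  | h_f (x : CartanLH ℓ) (i : Fin (ℓ + 1)) :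
      IsChevalleyRelator (⁅freeH x, freeF i⁆ + C.pair x (coroot i) • freeF i)
  | e_f_same (i : Fin (ℓ + 1)) : IsChevalleyRelator (⁅freeE i, freeF i⁆ - freeH (root i))
  | e_f_ne (i j : Fin (ℓ + 1)) (hij : i ≠ j) : IsChevalleyRelator ⁅freeE i, freeF j⁆

variable {C}

theorem IsChevalleyRelator.isRelator {x : FreeLieAlgebra ℂ (LGen ℓ)} (hx : C.IsChevalleyRelator x) :
    C.IsRelator x := by
  cases hx
  · exact .h_add _ _
  · exact .h_smul _ _
  · exact .h_h _ _
  · exact .h_e _ _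
  · exact .h_f _ _
  · exact .e_f_same _
  · exact .e_f_ne _ _ ‹_›

/-- A quotient of the free Lie algebra in which the Chevalley relations hold. -/
noncomputable def ChevalleySystem.ofQuotient {L : Type*} [LieRing L] [LieAlgebra ℂ L]
    (π : FreeLieAlgebra ℂ (LGen ℓ) →ₗ⁅ℂ⁆ L) (hsurj : Function.Surjective π)
    (hπ : ∀ x, C.IsChevalleyRelator x → π x = 0) : ChevalleySystem C L where
  h :=
    { toFun := fun x => π (freeH x)
      map_add' := fun x y => by
        have h := hπ _ (.h_add x y)
        rwa [map_sub, map_add, sub_eq_zero] at h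
      map_smul' := fun c x => by
        have h := hπ _ (.h_smul c x)
        rwa [map_sub, map_smul, sub_eq_zero] at h }
  e i := π (freeE i)
  f i := π (freeF i)
  lie_h_h x y := by
    have h := hπ _ (.h_h x y)
    rwa [LieHom.map_lie] at h
  lie_h_e x i := by
    have h := hπ _ (.h_e x i)
    rwa [map_sub, map_smul, LieHom.map_lie, sub_eq_zero] at h
  lie_h_f x i := by
    have h := hπ _ (.h_f x i)
    rwa [map_add, map_smul, LieHom.map_lie, add_eq_zero_iff_eq_neg] at h
  lie_e_f i j := by
    split_ifs with hij
    · subst hij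
      have h := hπ _ (.e_f_same i)
      rwa [map_sub, LieHom.map_lie, sub_eq_zero] at h
    · have h := hπ _ (.e_f_ne i j hij)
      rwa [LieHom.map_lie] at h
  gen := by
    set T := LieSubalgebra.lieSpan ℂ L (Set.range (fun x => π (freeH x)) ∪
      Set.range (fun i => π (freeE i)) ∪ Set.range fun i => π (freeF i)) with hT
    have hmem : ∀ g : LGen ℓ, π (FreeLieAlgebra.of ℂ g) ∈ T := by
      rintro (x | i | i)
      · exact LieSubalgebra.subset_lieSpan (Or.inl (Or.inl ⟨x, rfl⟩))
      · exact LieSubalgebra.subset_lieSpan (Or.inl (Or.inr ⟨i, rfl⟩))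
      · exact LieSubalgebra.subset_lieSpan (Or.inr ⟨i, rfl⟩)
    -- By the universal property π factors through T, so surjectivity of π gives T = ⊤.
    have hcomp : T.incl.comp (FreeLieAlgebra.lift ℂ fun g =>
        (⟨π (FreeLieAlgebra.of ℂ g), hmem g⟩ : T)) = π := by
      ext g; simp
    refine (eq_top_iff.2 fun x _ => ?_ : T = ⊤)
    obtain ⟨y, rfl⟩ := hsurj x
    rw [← hcomp]
    exact Subtype.property _

/-- The form is evaluated on a linear section; symmetry makes the one-sided condition on the kernel
sufficient in both arguments. -/
theorem exists_bilin_of_surjective {V W : Type*} [AddCommGroup V] [Module ℂ V] [AddCommGroup W]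
    [Module ℂ W] (f : V →ₗ[ℂ] W) (hf : Function.Surjective f) (B : LinearMap.BilinForm ℂ V)
    (hsymm : ∀ x y, B x y = B y x) (hB : ∀ x, f x = 0 → ∀ y, B x y = 0) :
    ∃ B' : LinearMap.BilinForm ℂ W, ∀ x y, B' (f x) (f y) = B x y := by
  obtain ⟨s, hs⟩ := f.exists_rightInverse_of_surjective (LinearMap.range_eq_top.2 hf)
  have hker : ∀ x, f (s (f x) - x) = 0 := fun x => by
    have := LinearMap.congr_fun hs (f x)
    rw [map_sub, sub_eq_zero]; exact this
  have hl : ∀ x y, B (s (f x)) y = B x y := fun x y => by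
    rw [← sub_eq_zero, ← LinearMap.sub_apply, ← map_sub]; exact hB _ (hker x) y
  exact ⟨B.compl₁₂ s s, fun x y => by
    rw [LinearMap.compl₁₂_apply, hl, hsymm, hl, hsymm]⟩

theorem exists_linear_of_surjective {V W U : Type*} [AddCommGroup V] [Module ℂ V] [AddCommGroup W]
    [Module ℂ W] [AddCommGroup U] [Module ℂ U] (f : V →ₗ[ℂ] W) (hf : Function.Surjective f)
    (p : V →ₗ[ℂ] U) (hp : ∀ x, f x = 0 → p x = 0) : ∃ p' : W →ₗ[ℂ] U, ∀ x, p' (f x) = p x := by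
  obtain ⟨s, hs⟩ := f.exists_rightInverse_of_surjective (LinearMap.range_eq_top.2 hf)
  refine ⟨p ∘ₗ s, fun x => ?_⟩
  rw [LinearMap.comp_apply, ← sub_eq_zero, ← map_sub]
  refine hp _ ?_
  have := LinearMap.congr_fun hs (f x)
  rw [map_sub, sub_eq_zero]; exact this

/-! #### Verma modules without Serre relations -/

section Verma

attribute [local instance] LieRing.ofAssociativeRing

variable (C) (lam : CartanLH ℓ →ₗ[ℂ] ℂ)

/-- The weight of the word `f_{i_1} ⋯ f_{i_r}` applied to a vector of weight `lam`. -/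
noncomputable def wordWeight (y : CartanLH ℓ) (w : List (Fin (ℓ + 1))) : ℂ :=
  lam y - (w.map fun j => C.pair y (coroot j)).sum

theorem wordWeight_cons (y : CartanLH ℓ) (j : Fin (ℓ + 1)) (w : List (Fin (ℓ + 1))) :
    C.wordWeight lam y (j :: w) = C.wordWeight lam y w - C.pair y (coroot j) := by
  simp only [wordWeight, List.map_cons, List.sum_cons]; ring

/-- The action of `ᴸ𝔥` on words in the `f_i`. -/
noncomputable def vermaH (y : CartanLH ℓ) : Module.End ℂ (List (Fin (ℓ + 1)) →₀ ℂ) :=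
  Finsupp.linearCombination ℂ fun w => C.wordWeight lam y w • Finsupp.single w 1

/-- The action of `f_i` on words in the `f_i`. -/
noncomputable def vermaF (i : Fin (ℓ + 1)) : Module.End ℂ (List (Fin (ℓ + 1)) →₀ ℂ) :=
  Finsupp.linearCombination ℂ fun w => Finsupp.single (i :: w) 1

/-- The result of applying `e_i` to a word in the `f_i`. -/
noncomputable def raiseWord (i : Fin (ℓ + 1)) : List (Fin (ℓ + 1)) → (List (Fin (ℓ + 1)) →₀ ℂ)
  | [] => 0
  | j :: w => vermaF j (raiseWord i w) +
      if i = j then C.wordWeight lam (root i) w • Finsupp.single w 1 else 0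

/-- The action of `e_i` on words in the `f_i`. -/
noncomputable def vermaE (i : Fin (ℓ + 1)) : Module.End ℂ (List (Fin (ℓ + 1)) →₀ ℂ) :=
  Finsupp.linearCombination ℂ (C.raiseWord lam i)

theorem vermaH_word (y : CartanLH ℓ) (w : List (Fin (ℓ + 1))) :
    C.vermaH lam y (Finsupp.single w 1) = C.wordWeight lam y w • Finsupp.single w 1 := by
  rw [vermaH, Finsupp.linearCombination_single, one_smul]

theorem vermaF_word (i : Fin (ℓ + 1)) (w : List (Fin (ℓ + 1))) :
    vermaF i (Finsupp.single w 1) = Finsupp.single (i :: w) 1 := by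
  rw [vermaF, Finsupp.linearCombination_single, one_smul]

theorem vermaE_word (i : Fin (ℓ + 1)) (w : List (Fin (ℓ + 1))) :
    C.vermaE lam i (Finsupp.single w 1) = C.raiseWord lam i w := by
  rw [vermaE, Finsupp.linearCombination_single, one_smul]

theorem end_ext {f g : Module.End ℂ (List (Fin (ℓ + 1)) →₀ ℂ)}
    (h : ∀ w, f (Finsupp.single w 1) = g (Finsupp.single w 1)) : f = g :=
  Finsupp.lhom_ext' fun w => LinearMap.ext_ring (h w)

theorem end_lie_apply (f g : Module.End ℂ (List (Fin (ℓ + 1)) →₀ ℂ))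
    (v : List (Fin (ℓ + 1)) →₀ ℂ) : ⁅f, g⁆ v = f (g v) - g (f v) := rfl

theorem vermaH_add (x y : CartanLH ℓ) :
    C.vermaH lam (x + y) = C.vermaH lam x + C.vermaH lam y := by
  refine end_ext fun w => ?_
  simp only [LinearMap.add_apply, vermaH_word, ← add_smul]
  congr 1
  simp only [wordWeight, ← pairL_apply, map_add, List.sum_map_add]; ring

theorem vermaH_smul (c : ℂ) (x : CartanLH ℓ) : C.vermaH lam (c • x) = c • C.vermaH lam x := by
  refine end_ext fun w => ?_
  simp only [LinearMap.smul_apply, vermaH_word, smul_smul]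
  congr 1
  simp only [wordWeight, ← pairL_apply, map_smul, smul_eq_mul, List.sum_map_mul_left]; ring

theorem vermaH_comm (x y : CartanLH ℓ) : ⁅C.vermaH lam x, C.vermaH lam y⁆ = 0 := by
  refine end_ext fun w => ?_
  simp only [end_lie_apply,
    vermaH_word, map_smul, smul_smul, LinearMap.zero_apply]
  rw [mul_comm, sub_self]

theorem vermaH_vermaF (y : CartanLH ℓ) (i : Fin (ℓ + 1)) :
    ⁅C.vermaH lam y, vermaF i⁆ = -(C.pair y (coroot i) • vermaF i) := by
  refine end_ext fun w => ?_
  simp only [end_lie_apply,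
    vermaH_word, vermaF_word, map_smul, LinearMap.neg_apply, LinearMap.smul_apply, wordWeight_cons]
  module

theorem vermaH_raiseWord (y : CartanLH ℓ) (i : Fin (ℓ + 1)) (w : List (Fin (ℓ + 1))) :
    C.vermaH lam y (C.raiseWord lam i w) =
      (C.wordWeight lam y w + C.pair y (coroot i)) • C.raiseWord lam i w := by
  induction w with
  | nil => simp [raiseWord]
  | cons j w ih =>
    have h := LinearMap.congr_fun (C.vermaH_vermaF lam y j) (C.raiseWord lam i w)
    simp only [end_lie_apply,
      LinearMap.neg_apply, LinearMap.smul_apply, sub_eq_iff_eq_add, ih, map_smul] at h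
    rw [raiseWord, map_add, h, wordWeight_cons]
    split_ifs with hij
    · subst hij
      rw [map_smul, vermaH_word]
      module
    · simp only [map_zero, add_zero]
      module

theorem vermaH_vermaE (y : CartanLH ℓ) (i : Fin (ℓ + 1)) :
    ⁅C.vermaH lam y, C.vermaE lam i⁆ = C.pair y (coroot i) • C.vermaE lam i := by
  refine end_ext fun w => ?_
  simp only [end_lie_apply,
    vermaH_word, vermaE_word, map_smul, LinearMap.smul_apply, vermaH_raiseWord]
  module

/-- True by construction: the recursion in `raiseWord` is the rule for moving e_i past the first
letter of a word. -/
theorem vermaE_vermaF (i j : Fin (ℓ + 1)) :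
    ⁅C.vermaE lam i, vermaF j⁆ = if i = j then C.vermaH lam (root i) else 0 := by
  refine end_ext fun w => ?_
  simp only [end_lie_apply,
    vermaF_word, vermaE_word, raiseWord]
  split_ifs
  · rw [vermaH_word, add_sub_cancel_left]
  · simp

/-- The action of the free Lie algebra on words in the `f_i`. -/
noncomputable def verma :
    FreeLieAlgebra ℂ (LGen ℓ) →ₗ⁅ℂ⁆ Module.End ℂ (List (Fin (ℓ + 1)) →₀ ℂ) :=
  FreeLieAlgebra.lift ℂ fun
    | .h y => C.vermaH lam y
    | .e i => C.vermaE lam i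
    | .f i => vermaF i

@[simp] theorem verma_freeH (y : CartanLH ℓ) : C.verma lam (freeH y) = C.vermaH lam y := by
  simp [verma, freeH]

@[simp] theorem verma_freeE (i : Fin (ℓ + 1)) : C.verma lam (freeE i) = C.vermaE lam i := by
  simp [verma, freeE]

@[simp] theorem verma_freeF (i : Fin (ℓ + 1)) : C.verma lam (freeF i) = vermaF i := by
  simp [verma, freeF]

theorem verma_relator {x : FreeLieAlgebra ℂ (LGen ℓ)} (hx : C.IsChevalleyRelator x) :
    C.verma lam x = 0 := by
  cases hx with
  | h_add x y => simp [vermaH_add]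
  | h_smul c x => simp [vermaH_smul]
  | h_h x y => rw [LieHom.map_lie, verma_freeH, verma_freeH, vermaH_comm]
  | h_e x i =>
    rw [map_sub, map_smul, LieHom.map_lie, verma_freeH, verma_freeE, vermaH_vermaE, sub_self]
  | h_f x i =>
    rw [map_add, map_smul, LieHom.map_lie, verma_freeH, verma_freeF, vermaH_vermaF]
    exact neg_add_cancel (C.pair x (coroot i) • vermaF i)
  | e_f_same i =>
    rw [map_sub, LieHom.map_lie, verma_freeH, verma_freeE, verma_freeF, vermaE_vermaF, if_pos rfl,
      sub_self]
  | e_f_ne i j hij => rw [LieHom.map_lie, verma_freeE, verma_freeF, vermaE_vermaF, if_neg hij]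

/-- The vacuum expectation value of an element of the free Lie algebra. -/
noncomputable def vacuum : FreeLieAlgebra ℂ (LGen ℓ) →ₗ[ℂ] ℂ where
  toFun x := C.verma lam x (Finsupp.single [] 1) []
  map_add' x y := by rw [map_add]; rfl
  map_smul' c x := by rw [map_smul]; rfl

theorem vacuum_apply (x : FreeLieAlgebra ℂ (LGen ℓ)) :
    C.vacuum lam x = C.verma lam x (Finsupp.single [] 1) [] := rfl

theorem vacuum_freeH (y : CartanLH ℓ) : C.vacuum lam (freeH y) = lam y := by
  simp [vacuum_apply, vermaH_word, wordWeight]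

/-- The ideal generated by the Chevalley relators. -/
noncomputable def chevalleyIdeal : LieIdeal ℂ (FreeLieAlgebra ℂ (LGen ℓ)) :=
  LieSubmodule.lieSpan ℂ (FreeLieAlgebra ℂ (LGen ℓ)) {x | C.IsChevalleyRelator x}

theorem vacuum_chevalleyIdeal {x : FreeLieAlgebra ℂ (LGen ℓ)} (hx : x ∈ C.chevalleyIdeal) :
    C.vacuum lam x = 0 := by
  have hker : C.chevalleyIdeal ≤ (C.verma lam).ker := by
    rw [chevalleyIdeal, LieSubmodule.lieSpan_le]
    exact fun x hx => LieHom.mem_ker.2 (C.verma_relator lam hx)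
  rw [vacuum_apply, LieHom.mem_ker.1 (hker hx)]; rfl

theorem vermaH_apply_nil (y : CartanLH ℓ) (v : List (Fin (ℓ + 1)) →₀ ℂ) :
    C.vermaH lam y v [] = lam y * v [] := by
  induction v using Finsupp.induction_linear with
  | zero => simp
  | add u v hu hv => rw [map_add, Finsupp.add_apply, hu, hv, Finsupp.add_apply, mul_add]
  | single w c =>
    rw [← mul_one c, ← smul_eq_mul, ← Finsupp.smul_single, map_smul, vermaH_word]
    by_cases hw : w = []
    · subst hw; simp [wordWeight, mul_comm]
    · simp [hw]

/-- ᴸ𝔥 acts diagonally on words, so both orders of the product contribute lam(y) times the vacuum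
value of x. -/
theorem vacuum_lie_freeH (y : CartanLH ℓ) (x : FreeLieAlgebra ℂ (LGen ℓ)) :
    C.vacuum lam ⁅freeH y, x⁆ = 0 := by
  rw [vacuum_apply, LieHom.map_lie, verma_freeH, end_lie_apply, vermaH_word, map_smul,
    Finsupp.sub_apply, vermaH_apply_nil, Finsupp.smul_apply]
  simp [wordWeight]

end Verma

/-! ### The algebra without Serre relations, and descent of the form to ᴸ𝔤 -/

variable (C)

/-- The Lie algebra defined by the Chevalley relations without the Serre relations. -/
abbrev PreLG : Type := FreeLieAlgebra ℂ (LGen ℓ) ⧸ C.chevalleyIdeal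

/-- The quotient map from the free Lie algebra. -/
noncomputable def toPreLG : FreeLieAlgebra ℂ (LGen ℓ) →ₗ⁅ℂ⁆ C.PreLG :=
  { (LieSubmodule.Quotient.mk' C.chevalleyIdeal : FreeLieAlgebra ℂ (LGen ℓ) →ₗ[ℂ]
      FreeLieAlgebra ℂ (LGen ℓ) ⧸ C.chevalleyIdeal) with
    map_lie' := fun {x y} => LieSubmodule.Quotient.mk_bracket C.chevalleyIdeal x y }

theorem toPreLG_surjective : Function.Surjective C.toPreLG :=
  LieSubmodule.Quotient.surjective_mk' C.chevalleyIdeal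

theorem toPreLG_eq_zero {x : FreeLieAlgebra ℂ (LGen ℓ)} : C.toPreLG x = 0 ↔ x ∈ C.chevalleyIdeal :=
  LieSubmodule.Quotient.mk_eq_zero' (N := C.chevalleyIdeal)

theorem toLG_surjective : Function.Surjective C.toLG :=
  LieSubmodule.Quotient.surjective_mk' C.relIdeal

theorem toLG_eq_zero_iff {x : FreeLieAlgebra ℂ (LGen ℓ)} : C.toLG x = 0 ↔ x ∈ C.relIdeal :=
  LieSubmodule.Quotient.mk_eq_zero' (N := C.relIdeal)

/-- The Chevalley generators of the algebra without Serre relations. -/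
noncomputable def preSystem : ChevalleySystem C C.PreLG :=
  .ofQuotient C.toPreLG C.toPreLG_surjective fun _ hx =>
    C.toPreLG_eq_zero.2 (LieSubmodule.subset_lieSpan hx)

/-- The Chevalley generators of `ᴸ𝔤`. -/
noncomputable def system : ChevalleySystem C C.LG :=
  .ofQuotient C.toLG C.toLG_surjective fun _ hx => C.toLG_eq_zero hx.isRelator

/-- The vacuum functional of highest weight lam restricts to lam on ᴸ𝔥. Letting lam run over the
coordinates of ᴸ𝔥 assembles these functionals into a projection; in particular ᴸ𝔥 embeds in the
algebra. -/
theorem exists_cartan_projection : ∃ p : C.PreLG →ₗ[ℂ] CartanLH ℓ,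
    (∀ y, p (C.preSystem.h y) = y) ∧ ∀ y x, p ⁅C.preSystem.h y, x⁆ = 0 := by
  let q : FreeLieAlgebra ℂ (LGen ℓ) →ₗ[ℂ] CartanLH ℓ := LinearMap.prod
    (LinearMap.pi fun i => C.vacuum (LinearMap.proj i ∘ₗ LinearMap.fst ℂ _ _))
    (C.vacuum (LinearMap.snd ℂ _ _))
  obtain ⟨p, hp⟩ := exists_linear_of_surjective (C.toPreLG : FreeLieAlgebra ℂ (LGen ℓ) →ₗ[ℂ] C.PreLG) C.toPreLG_surjective q
    fun x hx => by
      have hx := C.toPreLG_eq_zero.1 hx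
      ext i
      · exact C.vacuum_chevalleyIdeal _ hx
      · exact C.vacuum_chevalleyIdeal _ hx
  refine ⟨p, fun y => ?_, fun y x => ?_⟩
  · refine (hp (freeH y)).trans ?_
    ext i
    · exact C.vacuum_freeH _ y
    · exact C.vacuum_freeH _ y
  · obtain ⟨x, rfl⟩ := C.toPreLG_surjective x
    have h : ⁅C.preSystem.h y, C.toPreLG x⁆ = C.toPreLG ⁅freeH y, x⁆ :=
      (LieHom.map_lie C.toPreLG _ _).symm
    rw [h]
    refine (hp _).trans ?_
    ext i
    · exact C.vacuum_lie_freeH _ y x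
    · exact C.vacuum_lie_freeH _ y x

theorem toPreLG_ad_pow (x y : FreeLieAlgebra ℂ (LGen ℓ)) (n : ℕ) :
    C.toPreLG ((LieAlgebra.ad ℂ (FreeLieAlgebra ℂ (LGen ℓ)) x ^ n) y) =
      (LieAlgebra.ad ℂ C.PreLG (C.toPreLG x) ^ n) (C.toPreLG y) := by
  induction n with
  | zero => rfl
  | succ n ih =>
    rw [pow_succ', pow_succ', Module.End.mul_apply, Module.End.mul_apply, ← ih,
      LieAlgebra.ad_apply, LieAlgebra.ad_apply, LieHom.map_lie]

/-- The form on the algebra without Serre relations is pulled back to the free Lie algebra. Its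
radical is an ideal containing every relator of ᴸ𝔤, so it passes to the quotient. -/
theorem exists_isInvariantForm : ∃ B, C.IsInvariantForm B := by
  obtain ⟨p, hp, hp'⟩ := C.exists_cartan_projection
  obtain ⟨B, hsymm, hinv, hform, horth⟩ := C.preSystem.exists_form p hp hp'
  let F : LinearMap.BilinForm ℂ (FreeLieAlgebra ℂ (LGen ℓ)) :=
    B.compl₁₂ (C.toPreLG : FreeLieAlgebra ℂ (LGen ℓ) →ₗ[ℂ] C.PreLG) (C.toPreLG : FreeLieAlgebra ℂ (LGen ℓ) →ₗ[ℂ] C.PreLG)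
  have hF : ∀ x y, F x y = B (C.toPreLG x) (C.toPreLG y) := fun x y => rfl
  have hFsymm : ∀ x y, F x y = F y x := fun x y => hsymm _ _
  have hFinv : ∀ x y z, F ⁅x, y⁆ z = F x ⁅y, z⁆ := fun x y z => by
    rw [hF, hF, LieHom.map_lie, LieHom.map_lie, hinv]
  let J : LieIdeal ℂ (FreeLieAlgebra ℂ (LGen ℓ)) :=
    { carrier := {x | ∀ y, F x y = 0}
      add_mem' := fun {x x'} hx hx' y => by rw [map_add, LinearMap.add_apply, hx, hx', add_zero]
      zero_mem' := fun y => by simp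
      smul_mem' := fun c x hx y => by rw [map_smul, LinearMap.smul_apply, hx, smul_zero]
      lie_mem := fun {z x} hx y => by
        rw [← lie_skew, map_neg, LinearMap.neg_apply, hFinv, hx, neg_zero] }
  have hJ : C.relIdeal ≤ J := by
    have hrel : ∀ x, C.IsChevalleyRelator x → x ∈ J := fun x hx y => by
      rw [hF, C.toPreLG_eq_zero.2 (LieSubmodule.subset_lieSpan hx), map_zero, LinearMap.zero_apply]
    rw [relIdeal, LieSubmodule.lieSpan_le]
    intro x hx
    cases hx with
    | h_add x y => exact hrel _ (.h_add x y)
    | h_smul c x => exact hrel _ (.h_smul c x)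
    | h_h x y => exact hrel _ (.h_h x y)
    | h_e x i => exact hrel _ (.h_e x i)
    | h_f x i => exact hrel _ (.h_f x i)
    | e_f_same i => exact hrel _ (.e_f_same i)
    | e_f_ne i j hij => exact hrel _ (.e_f_ne i j hij)
    | serre_e i j hij =>
      intro y
      rw [hF, toPreLG_ad_pow]
      exact C.preSystem.serre_mem_radical B hinv horth hij _
    | serre_f i j hij =>
      intro y
      rw [hF, toPreLG_ad_pow]
      -- The Serre elements in the f_i are those in the e_i for the swapped system, whose gradation
      -- is reversed.
      refine C.preSystem.swap.serre_mem_radical B hinv (fun a b hab x hx z hz => ?_) hij _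
      rw [ChevalleySystem.component_swap] at hx hz
      exact horth (-a) (-b) (by omega) x hx z hz
  obtain ⟨B', hB'⟩ := exists_bilin_of_surjective (C.toLG : FreeLieAlgebra ℂ (LGen ℓ) →ₗ[ℂ] C.LG) C.toLG_surjective F hFsymm
    fun x hx => hJ (C.toLG_eq_zero_iff.1 hx : x ∈ C.relIdeal)
  have hB' : ∀ x y, B' (C.toLG x) (C.toLG y) = F x y := hB'
  refine ⟨B', fun x y => ?_, fun x y z => ?_, fun y y' => ?_⟩
  · obtain ⟨x, rfl⟩ := C.toLG_surjective x
    obtain ⟨y, rfl⟩ := C.toLG_surjective y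
    rw [hB', hB', hFsymm]
  · obtain ⟨x, rfl⟩ := C.toLG_surjective x
    obtain ⟨y, rfl⟩ := C.toLG_surjective y
    obtain ⟨z, rfl⟩ := C.toLG_surjective z
    rw [← LieHom.map_lie, ← LieHom.map_lie, hB', hB', hFinv]
  · exact (hB' _ _).trans (hform y y')

theorem isInvariantForm_form : C.IsInvariantForm C.form :=
  Classical.epsilon_spec C.exists_isInvariantForm

end AffineCartanDatum

/-! ### Opers -/

namespace AffineCartanDatum

variable {ℓ : ℕ} (C : AffineCartanDatum ℓ)

/-! ### The form on the generators, and the space 𝔞₁ -/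

theorem form_symm (x y : C.LG) : C.form x y = C.form y x := C.isInvariantForm_form.1 x y

theorem form_lie (x y z : C.LG) : C.form ⁅x, y⁆ z = C.form x ⁅y, z⁆ :=
  C.isInvariantForm_form.2.1 x y z

theorem form_hEmb (y y' : CartanLH ℓ) : C.form (C.hEmb y) (C.hEmb y') = C.formLH y y' :=
  C.isInvariantForm_form.2.2 y y'

theorem lie_hEmb_chevE (y : CartanLH ℓ) (i : Fin (ℓ + 1)) :
    ⁅C.hEmb y, C.chevE i⁆ = C.pair y (coroot i) • C.chevE i := C.system.lie_h_e y i

theorem lie_chevE_chevF (i j : Fin (ℓ + 1)) :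
    ⁅C.chevE i, C.chevF j⁆ = if i = j then C.hEmb (root i) else 0 := C.system.lie_e_f i j

/-- Replace ě_i by [ρ, ě_i] and move the bracket: the value is (ρ|[ě_i, f̌_j]). -/
theorem form_chevE_chevF (i j : Fin (ℓ + 1)) :
    C.form (C.chevE i) (C.chevF j) = if i = j then (C.aCheck i : ℂ) / C.a i else 0 := by
  have h := C.form_lie (C.hEmb C.rho) (C.chevE i) (C.chevF j)
  rw [lie_hEmb_chevE, pair_rho_coroot, one_smul, lie_chevE_chevF] at h
  rw [h]
  split_ifs
  · rw [form_hEmb, formLH_root, pair_rho_coroot, mul_one]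
  · rw [map_zero]

/-- The weights a_i in p₁ cancel the denominators of (f̌_i|ě_i) = ǎ_i/a_i. This is the origin of the
factor 1/h^∨ in the formula. -/
theorem form_pMinusOne_pOne : C.form C.pMinusOne C.pOne = C.hDual := by
  simp only [pMinusOne, pOne, map_sum, map_smul, LinearMap.sum_apply, hDual, Nat.cast_sum]
  refine Finset.sum_congr rfl fun i _ => ?_
  have := C.a_ne_zero i
  simp only [C.form_symm (C.chevF _), form_chevE_chevF, Finset.sum_ite_eq, Finset.mem_univ, if_true,
    smul_eq_mul]
  field_simp

theorem lie_pMinusOne_chevE (i : Fin (ℓ + 1)) :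
    ⁅C.pMinusOne, C.chevE i⁆ = -C.hEmb (root i) := by
  rw [← lie_skew, pMinusOne, lie_sum]
  simp [lie_chevE_chevF]

theorem lie_hEmb_rho_of_mem_grade {n : ℤ} {x : C.LG} (hx : x ∈ C.grade n) :
    ⁅C.hEmb C.rho, x⁆ = (n : ℂ) • x := by
  refine Submodule.iSup_induction _ (motive := fun x => ⁅C.hEmb C.rho, x⁆ = (n : ℂ) • x) hx ?_
    (by simp) (fun x y hx hy => by rw [lie_add, hx, hy, smul_add])
  rintro ⟨r, hr⟩ x hx
  have h := (Submodule.mem_iInf _).1 hx C.rho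
  have hpair : C.pair C.rho (∑ i, (r i : ℂ) • coroot i) = n := by
    have h1 : (∑ i, (r i : ℂ) • coroot i : CartanH ℓ) = (fun i => (r i : ℂ), 0) := by
      ext k
      · simp [coroot, Pi.single_apply, Finset.sum_apply, Prod.fst_sum]
      · simp [coroot, Prod.snd_sum]
    rw [h1, pair_eq_sum]
    simp only [pair_rho_coroot, mul_one, mul_zero, add_zero]
    exact_mod_cast congrArg (Int.cast : ℤ → ℂ) hr
  rw [hpair, LinearMap.mem_ker, LinearMap.sub_apply, sub_eq_zero] at h
  exact h

/-- For x = ∑ c_i ě_i one has [p₋₁, x] = −∑ c_i α_i. If this is a multiple of δ, then Ac = 0, and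
the kernel of A is spanned by a. -/
theorem principalGrade_one_le : C.principalGrade 1 ≤ Submodule.span ℂ {C.pOne} := by
  rintro x ⟨⟨hx, -⟩, hx'⟩
  have h1 : x ∈ C.system.component 1 :=
    C.system.mem_component_iff.2 (C.lie_hEmb_rho_of_mem_grade hx)
  rw [ChevalleySystem.component_one, Submodule.mem_span_range_iff_exists_fun] at h1
  obtain ⟨c, rfl⟩ := h1
  obtain ⟨t, ht⟩ := Submodule.mem_span_singleton.1 hx'
  have hlie : ⁅C.pMinusOne, ∑ i, c i • C.chevE i⁆ = -C.hEmb (∑ i, c i • root i) := by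
    simp only [lie_sum, lie_smul, lie_pMinusOne_chevE, map_sum, map_smul, smul_neg,
      Finset.sum_neg_distrib]
  have ht : t • C.hEmb C.delta = -C.hEmb (∑ i, c i • root i) := ht.trans hlie
  have hker : ∀ k, ∑ i, (C.A k i : ℂ) * c i = 0 := fun k => by
    -- Pairing with α_k turns the identity in ᴸ𝔤 into scalar equations, so injectivity of `hEmb` is
    -- not needed.
    have h := congrArg (fun z => C.form z (C.hEmb (root k))) ht
    have hs : C.pair (∑ i, c i • root i) (coroot k) = ∑ i, (C.A k i : ℂ) * c i := by
      rw [← pairL_apply, map_sum]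
      refine Finset.sum_congr rfl fun i _ => ?_
      rw [map_smul, pairL_apply, pair_root_coroot, smul_eq_mul, mul_comm]
    simp only [map_smul, map_neg, LinearMap.smul_apply, LinearMap.neg_apply, form_hEmb,
      formLH_root, pair_delta_coroot, hs, mul_zero, smul_zero] at h
    have h2 := neg_eq_zero.1 h.symm
    exact (mul_eq_zero.1 h2).resolve_left (div_ne_zero (C.aCheck_ne_zero k) (C.a_ne_zero k))
  have hc := C.kernel_complex c hker
  refine Submodule.mem_span_singleton.2 ⟨c 0, ?_⟩
  rw [pOne, Finset.smul_sum]
  refine Finset.sum_congr rfl fun i _ => ?_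
  rw [smul_smul, ← hc]
  rfl

/-! #### Meromorphic functions with values in `ᴸ𝔤` -/

theorem lgm_lie_tmul (f g : RatFunc ℂ) (x y : C.LG) :
    (⁅(f ⊗ₜ[ℂ] x : C.LGM), (g ⊗ₜ[ℂ] y : C.LGM)⁆ : C.LGM) = (f * g) ⊗ₜ[ℂ] ⁅x, y⁆ := rfl

theorem formM_tmul (f g : RatFunc ℂ) (x y : C.LG) :
    C.formM (f ⊗ₜ[ℂ] x) (g ⊗ₜ[ℂ] y) = C.form x y • (f * g) := rfl

theorem derivLGM_tmul (f : RatFunc ℂ) (x : C.LG) :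
    C.derivLGM (f ⊗ₜ[ℂ] x) = ratDeriv f ⊗ₜ[ℂ] x := rfl

theorem formM_symm (x y : C.LGM) : C.formM x y = C.formM y x := by
  induction x using TensorProduct.induction_on with
  | zero => simp
  | add x x' hx hx' => rw [map_add, map_add, LinearMap.add_apply, hx, hx']
  | tmul f x =>
    induction y using TensorProduct.induction_on with
    | zero => simp
    | add y y' hy hy' => rw [map_add, map_add, LinearMap.add_apply, hy, hy']
    | tmul g y => rw [formM_tmul, formM_tmul, form_symm, mul_comm]

theorem formM_lie (x y z : C.LGM) : C.formM ⁅x, y⁆ z = C.formM x ⁅y, z⁆ := by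
  induction x using TensorProduct.induction_on with
  | zero => simp
  | add x x' hx hx' => simp only [add_lie, map_add, LinearMap.add_apply, hx, hx']
  | tmul f x =>
    induction y using TensorProduct.induction_on with
    | zero => simp
    | add y y' hy hy' => simp only [add_lie, lie_add, map_add, LinearMap.add_apply, hy, hy']
    | tmul g y =>
      induction z using TensorProduct.induction_on with
      | zero => simp
      | add z z' hz hz' => simp only [lie_add, map_add, hz, hz']
      | tmul k z => rw [lgm_lie_tmul, lgm_lie_tmul, formM_tmul, formM_tmul, form_lie, mul_assoc]

theorem derivLGM_lie_const (x : C.LGM) (y : C.LG) :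
    C.derivLGM ⁅x, C.const y⁆ = ⁅C.derivLGM x, C.const y⁆ := by
  induction x using TensorProduct.induction_on with
  | zero => simp
  | add x x' hx hx' => simp only [add_lie, map_add, hx, hx']
  | tmul f x =>
    rw [const, smulConst, lgm_lie_tmul, derivLGM_tmul, derivLGM_tmul, lgm_lie_tmul, mul_one, mul_one]

theorem lie_const_rho {n : ℕ} {x : C.LGM} (hx : x ∈ (C.grade (n : ℤ)).baseChange (RatFunc ℂ)) :
    ⁅C.const (C.hEmb C.rho), x⁆ = (n : ℂ) • x := by
  obtain ⟨y, rfl⟩ := hx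
  induction y with
  | zero => simp
  | add y y' hy hy' => rw [map_add, lie_add, hy, hy', smul_add]
  | tmul f y =>
    have h := C.lie_hEmb_rho_of_mem_grade y.2
    rw [LinearMap.baseChange_tmul, Submodule.subtype_apply, const, smulConst, lgm_lie_tmul, h,
      one_mul, TensorProduct.tmul_smul]
    simp

theorem exists_smulConst_pOne {x : C.LGM}
    (hx : x ∈ (C.principalGrade ((1 : ℕ) : ℤ)).baseChange (RatFunc ℂ)) :
    ∃ v, x = C.smulConst v C.pOne := by
  obtain ⟨y, rfl⟩ := hx
  induction y with
  | zero => exact ⟨0, by simp [smulConst]⟩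
  | add y y' hy hy' =>
    obtain ⟨v, hv⟩ := hy
    obtain ⟨v', hv'⟩ := hy'
    exact ⟨v + v', by rw [map_add, hv, hv', smulConst, smulConst, smulConst, TensorProduct.add_tmul]⟩
  | tmul f y =>
    obtain ⟨c, hc⟩ := Submodule.mem_span_singleton.1 (C.principalGrade_one_le y.2)
    refine ⟨c • f, ?_⟩
    rw [LinearMap.baseChange_tmul, Submodule.subtype_apply, ← hc, smulConst, TensorProduct.smul_tmul]

/-! #### The gauge-invariant function -/

/-- The function `½ (b_0 | b_0) + (ρ | b_0') + (p_{-1} | b_1)` of a connection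
`d + p_{-1} dz + b dz`. -/
noncomputable def operFunction (b : ℕ → C.LGM) : RatFunc ℂ :=
  1 / 2 * C.formM (b 0) (b 0) + C.formM (C.const (C.hEmb C.rho)) (C.derivLGM (b 0)) +
    C.formM (C.const C.pMinusOne) (b 1)

theorem formM_smul_complex (c : ℂ) (x y : C.LGM) : C.formM x (c • y) = c • C.formM x y := by
  rw [← algebraMap_smul (RatFunc ℂ) c y, map_smul, algebraMap_smul]

/-- Index j of `withCyclic b` carries degree j − 1, so degree 0 is index 1: only the terms k ≤ 1
occur, and the logarithmic derivative starts in degree 1. -/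
theorem gaugeTransform_zero (m b : ℕ → C.LGM) (hm : m 0 = 0) :
    C.gaugeTransform m b 0 = b 0 + ⁅m 1, C.const C.pMinusOne⁆ := by
  simp [gaugeTransform, AdExp, logDerivExp, adFam, withCyclic, Finset.sum_range_succ,
    Finset.Nat.antidiagonal_succ, hm]

theorem gaugeTransform_one (m b : ℕ → C.LGM) (hm : m 0 = 0) :
    C.gaugeTransform m b 1 = b 1 + (⁅m 1, b 0⁆ + ⁅m 2, C.const C.pMinusOne⁆) +
      (2 : ℂ)⁻¹ • ⁅m 1, ⁅m 1, C.const C.pMinusOne⁆⁆ - C.derivLGM (m 1) := by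
  simp [gaugeTransform, AdExp, logDerivExp, adFam, withCyclic, Finset.sum_range_succ,
    Finset.Nat.antidiagonal_succ, hm]

/-- With c = [m₁, p₋₁], the gain (b₀|c) + ½(c|c) of the quadratic term is cancelled by `h2` and
`h4`, the m₂ term vanishes by `h3`, and the two derivative terms cancel by `h1`. -/
theorem operFunction_gaugeTransform (m b : ℕ → C.LGM) (hm : C.IsNPlus m) :
    C.operFunction (C.gaugeTransform m b) = C.operFunction b := by
  set p := C.const C.pMinusOne with hp
  set r := C.const (C.hEmb C.rho) with hr
  set c := ⁅m 1, p⁆ with hc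
  have h1 : C.formM r ⁅C.derivLGM (m 1), p⁆ = C.formM p (C.derivLGM (m 1)) := by
    have h := C.lie_const_rho (hm.2 1)
    rw [Nat.cast_one, one_smul] at h
    -- ρ is constant in z, so m₁′ still has degree 1 and is fixed by ad ρ.
    have h' : ⁅r, C.derivLGM (m 1)⁆ = C.derivLGM (m 1) := by
      have h2 := congrArg C.derivLGM h
      rw [← lie_skew, map_neg, derivLGM_lie_const, ← lie_skew, neg_neg] at h2
      exact h2
    rw [← formM_lie, h', formM_symm]
  have h2 : C.formM p ⁅m 1, b 0⁆ = -C.formM (b 0) c := by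
    rw [← formM_lie, ← lie_skew, map_neg, LinearMap.neg_apply, formM_symm]
  -- Invariance and skew symmetry make this quantity its own negative.
  have h3 : C.formM p ⁅m 2, p⁆ = 0 := by
    have h : C.formM p ⁅m 2, p⁆ = -C.formM p ⁅m 2, p⁆ := by
      conv_lhs => rw [← formM_lie, ← lie_skew, map_neg, LinearMap.neg_apply, formM_symm]
    exact self_eq_neg.1 h
  have h4 : C.formM p ⁅m 1, c⁆ = -C.formM c c := by
    rw [← formM_lie, ← lie_skew, map_neg, LinearMap.neg_apply]
  have h5 : ((2 : ℂ)⁻¹ • (-C.formM c c) : RatFunc ℂ) = -(1 / 2 * C.formM c c) := by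
    rw [Algebra.smul_def, map_inv₀, map_ofNat]
    ring
  rw [operFunction, gaugeTransform_zero C m b hm.1, gaugeTransform_one C m b hm.1, operFunction]
  simp only [← hp, ← hr, ← hc, map_add, map_sub, LinearMap.add_apply, formM_smul_complex, h2, h3,
    h4, h5]
  rw [hc, derivLGM_lie_const, ← hp, h1, ← hc, C.formM_symm c (b 0)]
  ring

/-- The function attached to an oper. -/
noncomputable def operInvariant (φ : RatFunc ℂ) : C.Oper φ → RatFunc ℂ :=
  Quot.lift (fun D => C.operFunction D.1.b) fun D D' ⟨m, hm, h⟩ => by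
    rw [h, operFunction_gaugeTransform C m D.1.b hm]

/-- This normalisation of ρ is why no terms in φ² or φ′ appear in the formula. -/
theorem formM_rho_rho (f g : RatFunc ℂ) :
    C.formM (C.smulConst f (C.hEmb C.rho)) (C.smulConst g (C.hEmb C.rho)) = 0 := by
  rw [smulConst, smulConst, formM_tmul, form_hEmb, C.isRho_rho.2, zero_smul]

theorem formM_pMinusOne_smulConst_pOne (v : RatFunc ℂ) :
    C.formM (C.const C.pMinusOne) (C.smulConst v C.pOne) = C.hDual * v := by
  rw [const, smulConst, smulConst, formM_tmul, form_pMinusOne_pOne, one_mul, Algebra.smul_def,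
    map_natCast]

theorem smulConst_eq_smul_const (f : RatFunc ℂ) (x : C.LG) : C.smulConst f x = f • C.const x := by
  rw [const, smulConst, smulConst, TensorProduct.smul_tmul', smul_eq_mul, mul_one]

/-- Used twice: for the given representative, and for the quasi-canonical one, where the degree-0
part of u is zero. -/
theorem operFunction_sub_rho (f : RatFunc ℂ) (u : ℕ → C.LGM) :
    C.operFunction (u - C.inDegreeZero (C.smulConst f (C.hEmb C.rho))) =
      1 / 2 * C.formM (u 0) (u 0) + C.formM (C.const (C.hEmb C.rho)) (C.derivLGM (u 0)) -
        f * C.formM (C.const (C.hEmb C.rho)) (u 0) + C.formM (C.const C.pMinusOne) (u 1) := by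
  have h1 : C.derivLGM (C.smulConst f (C.hEmb C.rho)) = C.smulConst (ratDeriv f) (C.hEmb C.rho) :=
    rfl
  have h2 : C.formM (C.const (C.hEmb C.rho)) (C.smulConst (ratDeriv f) (C.hEmb C.rho)) = 0 :=
    C.formM_rho_rho _ _
  have h3 : C.formM (C.smulConst f (C.hEmb C.rho)) (u 0) =
      f * C.formM (C.const (C.hEmb C.rho)) (u 0) := by
    rw [smulConst_eq_smul_const, map_smul, LinearMap.smul_apply, smul_eq_mul]
  simp only [operFunction, inDegreeZero, Pi.sub_apply, if_true, one_ne_zero, if_false, sub_zero,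
    map_sub, LinearMap.sub_apply, h1, h2, h3, formM_rho_rho,
    C.formM_symm (u 0) (C.smulConst f (C.hEmb C.rho))]
  ring

end AffineCartanDatum

theorem proposition3p8 {ℓ : ℕ} (C : AffineCartanDatum ℓ) (φ : RatFunc ℂ)
    (X : C.Oper φ)
    (D : C.TwistedConn φ) (hD : C.operClass φ D = X)
    (u : ℕ → C.LGM) (hu : C.IsDerivedBPlus u)
    (hDu : D.1.b = u - C.inDegreeZero (C.smulConst (φ / (C.hDual : RatFunc ℂ)) (C.hEmb C.rho)))
    (Q : C.TwistedConn φ) (hQ : C.operClass φ Q = X) (hQc : C.IsQuasiCanonical φ Q.1)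
    (v : RatFunc ℂ) :
    Q.1.b 1 = C.smulConst v C.pOne ↔
      v = (C.hDual : RatFunc ℂ)⁻¹ *
        (1 / 2 * C.formM (u 0) (u 0)
          + C.formM (C.const (C.hEmb C.rho)) (C.derivLGM (u 0))
          - (C.hDual : RatFunc ℂ)⁻¹ * φ * C.formM (C.const (C.hEmb C.rho)) (u 0)
          + C.formM (C.const C.pMinusOne) (u 1)) := by
  have hinv : C.operFunction Q.1.b = C.operFunction D.1.b :=
    congrArg (C.operInvariant φ) (hQ.trans hD.symm)
  have hh : (C.hDual : RatFunc ℂ) ≠ 0 := Nat.cast_ne_zero.2 C.hDual_pos.ne'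
  obtain ⟨w, hw⟩ := C.exists_smulConst_pOne (hQc.2 1 le_rfl)
  have hQw : C.operFunction Q.1.b = C.hDual * w := by
    have h := C.operFunction_sub_rho (φ / (C.hDual : RatFunc ℂ)) (Function.update Q.1.b 0 0)
    -- The degree-0 component of a quasi-canonical form is exactly the ρ term, so removing it leaves
    -- a family with zero in degree 0.
    have hb : Q.1.b = Function.update Q.1.b 0 0 -
        C.inDegreeZero (C.smulConst (φ / (C.hDual : RatFunc ℂ)) (C.hEmb C.rho)) := by
      funext n
      rcases n with _ | n
      · simp [AffineCartanDatum.inDegreeZero, hQc.1]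
      · simp [AffineCartanDatum.inDegreeZero]
    rw [← hb] at h
    rw [h]
    simp [hw, AffineCartanDatum.formM_pMinusOne_smulConst_pOne]
  rw [hDu, AffineCartanDatum.operFunction_sub_rho, hQw, div_eq_inv_mul φ] at hinv
  rw [← hinv, inv_mul_cancel_left₀ hh, hw]
  constructor
  · intro h
    -- Pairing with p₋₁ recovers the coefficient of p₁ up to the nonzero factor h^∨, so that
    -- coefficient is unique.
    have := congrArg (C.formM (C.const C.pMinusOne)) h
    rw [AffineCartanDatum.formM_pMinusOne_smulConst_pOne, AffineCartanDatum.formM_pMinusOne_smulConst_pOne] at this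
    exact (mul_left_cancel₀ hh this).symm
  · rintro rfl; rfl
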